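/- **Setting.** Let $R=\bigoplus_{j\in\mathbb Z}\mathcal A_j$ be a commutative $\mathbb Z$-graded $\mathbb Q$-algebra with a derivation $\partial$, $\partial(\mathcal A_j)\subset\mathcal A_{j+1}$, containing an element $x\in\mathcal A_{-1}$ with $\partial x=1$, and let $\mathcal A$ be the algebra of formal sums $\sum_{j\ge k}a_j$, $a_j\in\mathcal A_j$, $k\in\mathbb Z$. Formal operators $\sum_{i\in\mathbb Z} f_i\partial^i$, $f_i\in\mathcal A$, are multiplied by $$f\partial^i\cdot g\partial^l=\sum_{r\ge0}\binom ir f\,\partial^r(g)\,\partial^{i+l-r}.$$ $\mathcal D^-$ is the algebra of operators with $f_i=0$ for $i\gg0$. Giving $a\partial^i$ with $a\in\mathcal A_j$ the total degree $i+j$, $\mathcal D^+$ is the algebra of operators whose total degree is bounded below and whose part of each total degree has order in $\partial$ bounded above. For $A=\sum f_i\partial^i$ put $A_+=\sum_{i\ge0}f_i\partial^i$, $A_-=\sum_{i<0}f_i\partial^i$, $A^*=\sum(-\partial)^if_i$. Let $$\Phi=1+\sum_{i\ge1}a_i\partial^{-i}\in\mathcal D^-,\qquad \hat\Phi=v\Bigl(1+\sum_{i\ge1}b_i\partial^i\Bigr)\in\mathcal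 D^+,$$ with $v\in\mathcal A$ invertible (written $v=e^f$), and suppose that they have inverses $\Phi^{-1}\in\mathcal D^-$ and $\hat\Phi^{-1}\in\mathcal D^+$, the latter without negative powers of $\partial$. For $k\in\mathbb Z$ put $P^k=\Phi\partial^k\Phi^{-1}$, $\hat P^k=\hat\Phi\partial^{-k}\hat\Phi^{-1}$. Fix $n\ge1$ and impose the $\mathrm{cKP}_{n,1}$ constraint $$L:=P^n=\hat P .$$ Let $t_1=x,t_2,t_3,\dots\in\mathcal A$, finitely many nonzero, with $\partial t_k=0$ for $k\ge2$, and put $$M=\Phi\Bigl(\sum_{k\ge1}kt_k\partial^{k-1}\Bigr)\Phi^{-1},\qquad \hat M=\hat\Phi x\hat\Phi^{-1},\qquad S_p=\tfrac1nMP^{np+1}+\hat M\hat P^{p-1}.$$ The flows $\partial/\partial s'_p$ ($p\ge-1$, with constants $\kappa,\lambda$) are defined by $$\frac{\partial\Phi}{\partial s'_p}=-\bigl(S_p+(\kappa p+\lambda)\hat P^p\bigr)_-\Phi,\qquad \frac{\partial\hat\Phi}{\partial s'_p}=\bigl(S_p+(\kappa p+\lambda)\hat P^p\bigr)_+\hat\Phi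 ,$$ and reduce to $$\frac{\partial L}{\partial s'_p}=\bigl[-\bigl(S_p+(\kappa p+\lambda)\hat P^p\bigr)_-,\,L\bigr].$$ The flows of Aratyn, Nissimov and Pacheva are $$\frac{\partial L}{\partial\tilde s_p}=\Bigl[-\tfrac1n\bigl(MP^{np+1}\bigr)_-+Y_p,\;L\Bigr],\qquad p\ge-1,$$ where $Y_{-1}=Y_0=Y_1=0$ and $$Y_p=\sum_{j=0}^{p-1}\frac{2j-p+1}{2}\,L^{p-j-1}(v)\,\partial^{-1}\,(L^*)^j(w),\qquad p\ge2,$$ with $v=\hat\Phi(1)$ and $w=(\hat\Phi^{-1})^*(1)$. The nonlocal actions are those with the integration constants fixed by $\partial^{-k}(1)=x^k/k!$ for $k\ge0$ (and $\partial^k(1)=0$ for $k\ge1$), namely $L^k(v)=(L^k\hat\Phi)(1)$ and $(L^*)^k(w)=\bigl((L^*)^k(\hat\Phi^{-1})^*\bigr)(1)$. **Proposition.** For $\kappa=-\tfrac12$, $\lambda=\tfrac12$ and all $p\ge-1$ one has $$\frac{\partial L}{\partial\tilde s_p}=\frac{\partial L}{\partial s'_p}.$$ That is, the two commutators on the right-hand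 sides above coincide; and if $\delta,\delta'$ are derivations of $\mathcal A$ commuting with $\partial$, acting on operators coefficientwise, such that $\delta L$ is the right-hand side of the flow $\partial/\partial\tilde s_p$ and $\delta'\Phi,\delta'\hat\Phi$ are the right-hand sides of the flow $\partial/\partial s'_p$, then $\delta L=\delta'L$. -/

import Mathlib

/-!  The setting.  `R = ⨁ 𝒜 j` is a commutative `ℤ`-graded `ℚ`-algebra with a derivation `D` of
degree one; `𝒜`-valued formal sums `∑ g_j` (`g_j ∈ 𝒜 j`, `g_j = 0` for `j ≪ 0`) form the complete
graded differential algebra over which pseudo-differential operators are taken.  The grading is by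
`ℤ` because the independent variable `x`, with `D x = 1`, has degree `-1`. -/

namespace CKP

/-- A formal sum `∑ⱼ g j`, where `g j` is the component of degree `j`. -/
abbrev Fn (R : Type*) := ℤ → R

/-- A formal operator `∑ᵢ (∑ⱼ X i j) ∂^i`: `X i` is the coefficient of `∂^i`, and `X i j` is the
component of degree `j` of that coefficient. -/
abbrev Op (R : Type*) := ℤ → ℤ → R

section

variable {R : Type*} [CommRing R] [Algebra ℚ R]

/-- The formal sum with the single component `c`, in degree `e`. -/
def homog (e : ℤ) (c : R) : Fn R := fun j => if j = e then c else 0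

/-- Membership in the complete graded algebra: components of the right degree, and bounded below. -/
def IsFn (𝒜 : ℤ → Submodule ℚ R) (g : Fn R) : Prop :=
  (∀ j, g j ∈ 𝒜 j) ∧ ∃ k : ℤ, ∀ j < k, g j = 0

/-- The product of two formal sums. -/
noncomputable def fnMul (g h : Fn R) : Fn R := fun d => ∑ᶠ j : ℤ, g j * h (d - j)

/-- The derivation on formal sums (it raises the degree by one). -/
def fnDer (D : Derivation ℚ R R) (g : Fn R) : Fn R := fun j => D (g (j - 1))

/-- Pseudo-differential operators of the first type, `∑_{i ≤ k} f_i ∂^i`. -/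
def IsDminus (𝒜 : ℤ → Submodule ℚ R) (X : Op R) : Prop :=
  (∀ i, IsFn 𝒜 (X i)) ∧ ∃ k : ℤ, ∀ i > k, X i = 0

/-- Pseudo-differential operators of the second type.  Give `a ∂^i` with `a ∈ 𝒜 j` the total degree
`i + j`.  The total degree is bounded below, and the part of each total degree has bounded order.
If `𝒜 j = 0` for `j < 0`, the last condition is automatic and these are the sums
`∑_i ∑_{j ≥ max(0, k - i)} a_{i,j} ∂^i`. -/
def IsDplus (𝒜 : ℤ → Submodule ℚ R) (X : Op R) : Prop :=
  (∀ i j, X i j ∈ 𝒜 j) ∧ (∃ k : ℤ, ∀ i j, i + j < k → X i j = 0) ∧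
    ∀ d : ℤ, ∃ k : ℤ, ∀ i > k, X i (d - i) = 0

/-- The operator of multiplication by `g`. -/
def ofFn (g : Fn R) : Op R := fun i => if i = 0 then g else 0

/-- The operator `∂^k`. -/
def dpow (k : ℤ) : Op R := fun i => if i = k then homog 0 1 else 0

/-- The product determined by `f ∂^i · g ∂^l = ∑_{r ≥ 0} (i choose r) f ∂^r(g) ∂^(i + l - r)`.
In the coefficient of `∂^m`, degree `d`, the sum runs over the power `i` and the degree `j` in the
left factor and over `r`; the power in the right factor is `m + r - i`, the degree `d - r - j`.
The sum is finite when both factors are of the first type, and when both are of the second. -/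
noncomputable def mul (D : Derivation ℚ R R) (X Y : Op R) : Op R := fun m d =>
  ∑ᶠ q : ℤ × ℕ × ℤ,
    Ring.choose q.1 q.2.1 •
      (X q.1 q.2.2 * D^[q.2.1] (Y (m + q.2.1 - q.1) (d - q.2.1 - q.2.2)))

/-- The commutator `[X, Y] = X Y - Y X`. -/
noncomputable def comm (D : Derivation ℚ R R) (X Y : Op R) : Op R := mul D X Y - mul D Y X

/-- The natural powers of an operator. -/
noncomputable def npow (D : Derivation ℚ R R) (X : Op R) : ℕ → Op R
  | 0 => dpow 0
  | k + 1 => mul D X (npow D X k)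

/-- The differential part. -/
def pos (X : Op R) : Op R := fun i => if 0 ≤ i then X i else 0

/-- The negative part. -/
def neg (X : Op R) : Op R := fun i => if i < 0 then X i else 0

/-- The formal adjoint, `(∑ f_i ∂^i)^* = ∑ (-∂)^i f_i = ∑_i ∑_r (-1)^i (i choose r) ∂^r(f_i)
∂^(i - r)`; in the coefficient of `∂^m` one has `i = m + r`. -/
noncomputable def adj (D : Derivation ℚ R R) (X : Op R) : Op R := fun m d =>
  ∑ᶠ r : ℕ, (((m + r).negOnePow : ℤ) * Ring.choose (m + (r : ℤ)) r) • D^[r] (X (m + r) (d - r))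

/-- The function `U(1)` for an operator of the form `U = ∑_{i ≥ -N} f_i ∂^i`, where `∂^i(1) = 0` for
`i > 0` and the integration constants are fixed by `∂^(-k)(1) = x^k / k!`.  (This is the convention
`∂^i (e^{xz}) = z^i e^{xz}`, `i ∈ ℤ`, read off at `z^0`.) -/
noncomputable def applyOne (x : R) (U : Op R) : Fn R := fun d =>
  ∑ᶠ k : ℕ, ((k.factorial : ℚ)⁻¹) • (U (-(k : ℤ)) (d + k) * x ^ k)

/-- The (nonlocal) action `B(g) = (B U)(1)` of an operator `B` on a function `g` that is presented
as `g = U(1)`. -/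
noncomputable def act (D : Derivation ℚ R R) (x : R) (B U : Op R) : Fn R :=
  applyOne x (mul D B U)

/-- `Φ = 1 + ∑_{i ≥ 1} a_i ∂^(-i)` of the first type and `Φh = v (1 + ∑_{i ≥ 1} b_i ∂^i)` of the
second type, `v` an invertible function, with their inverses `Φinv` (of the first type) and
`Φhinv = (1 + ∑_{i ≥ 1} b'_i ∂^i) v⁻¹` (of the second type, without negative powers of `∂`). -/
structure IsDressing (𝒜 : ℤ → Submodule ℚ R) (D : Derivation ℚ R R)
    (Φ Φinv Φh Φhinv : Op R) : Prop where
  mem : IsDminus 𝒜 Φ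
  coeff_zero : Φ 0 = homog 0 1
  coeff_pos : ∀ i > 0, Φ i = 0
  inv_mem : IsDminus 𝒜 Φinv
  mul_inv : mul D Φ Φinv = dpow 0
  inv_mul : mul D Φinv Φ = dpow 0
  hat_mem : IsDplus 𝒜 Φh
  hat_coeff_neg : ∀ i < 0, Φh i = 0
  hat_coeff_zero : ∃ u : Fn R, IsFn 𝒜 u ∧ fnMul (Φh 0) u = homog 0 1
  hat_inv_mem : IsDplus 𝒜 Φhinv
  hat_inv_coeff_neg : ∀ i < 0, Φhinv i = 0
  hat_mul_inv : mul D Φh Φhinv = dpow 0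
  hat_inv_mul : mul D Φhinv Φh = dpow 0

/-- The time variables: `t 1 = x`, and `t k` is a constant for `D` if `k ≥ 2`; only finitely many of
them are nonzero.  (`t 0` plays no role.) -/
structure IsTimes (𝒜 : ℤ → Submodule ℚ R) (D : Derivation ℚ R R) (x : R) (t : ℕ → Fn R) :
    Prop where
  mem : ∀ k, IsFn 𝒜 (t k)
  one : t 1 = homog (-1) x
  const : ∀ k ≥ 2, fnDer D (t k) = 0
  finite : ∃ N, ∀ k > N, t k = 0

/-- `P^k = Φ ∂^k Φ⁻¹`, `k ∈ ℤ`. -/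
noncomputable def Ppow (D : Derivation ℚ R R) (Φ Φinv : Op R) (k : ℤ) : Op R :=
  mul D (mul D Φ (dpow k)) Φinv

/-- `P̂^k = Φ̂ ∂^(-k) Φ̂⁻¹`, `k ∈ ℤ`. -/
noncomputable def Phpow (D : Derivation ℚ R R) (Φh Φhinv : Op R) (k : ℤ) : Op R :=
  mul D (mul D Φh (dpow (-k))) Φhinv

/-- `∑_{k ≥ 1} k t_k ∂^(k-1)`. -/
def Xi (t : ℕ → Fn R) : Op R := fun i => if 0 ≤ i then (i + 1) • t (i + 1).toNat else 0

/-- The Orlov–Schulman operator `M = Φ (∑_{k ≥ 1} k t_k ∂^(k-1)) Φ⁻¹`. -/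
noncomputable def opM (D : Derivation ℚ R R) (t : ℕ → Fn R) (Φ Φinv : Op R) : Op R :=
  mul D (mul D Φ (Xi t)) Φinv

/-- The Orlov–Schulman operator `M̂ = Φ̂ x Φ̂⁻¹`. -/
noncomputable def opMh (D : Derivation ℚ R R) (x : R) (Φh Φhinv : Op R) : Op R :=
  mul D (mul D Φh (ofFn (homog (-1) x))) Φhinv

/-- `S_p = (1/n) M P^(np+1) + M̂ P̂^(p-1)`. -/
noncomputable def opS (D : Derivation ℚ R R) (x : R) (t : ℕ → Fn R) (n : ℕ)
    (Φ Φinv Φh Φhinv : Op R) (p : ℤ) : Op R :=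
  (1 / (n : ℚ)) • mul D (opM D t Φ Φinv) (Ppow D Φ Φinv (n * p + 1)) +
    mul D (opMh D x Φh Φhinv) (Phpow D Φh Φhinv (p - 1))

/-- `S'_p = S_p + (κ p + l) P̂^p`. -/
noncomputable def opS' (D : Derivation ℚ R R) (x : R) (t : ℕ → Fn R) (n : ℕ)
    (Φ Φinv Φh Φhinv : Op R) (κ l : ℚ) (p : ℤ) : Op R :=
  opS D x t n Φ Φinv Φh Φhinv p + (κ * p + l) • Phpow D Φh Φhinv p

/-- The right-hand side `[-(S'_p)_-, L]` of the reduced flow `∂L/∂s'_p`, where `L = P^n`. -/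
noncomputable def reducedFlow (D : Derivation ℚ R R) (x : R) (t : ℕ → Fn R) (n : ℕ)
    (Φ Φinv Φh Φhinv : Op R) (κ l : ℚ) (p : ℤ) : Op R :=
  comm D (-neg (opS' D x t n Φ Φinv Φh Φhinv κ l p)) (Ppow D Φ Φinv n)

/-- `L^k(v)` for `v = Φ̂(1)`. -/
noncomputable def Lv (D : Derivation ℚ R R) (x : R) (L Φh : Op R) (k : ℕ) : Fn R :=
  act D x (npow D L k) Φh

/-- `(L^*)^k(w)` for `w = (Φ̂⁻¹)^*(1)`. -/
noncomputable def Lw (D : Derivation ℚ R R) (x : R) (L Φhinv : Op R) (k : ℕ) : Fn R :=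
  act D x (npow D (adj D L) k) (adj D Φhinv)

/-- `Y_p = ∑_{j=0}^{p-1} (2j-p+1)/2 · L^(p-j-1)(v) ∂⁻¹ (L^*)^j(w)` for `p ≥ 2`, and `Y_p = 0`
otherwise. -/
noncomputable def opY (D : Derivation ℚ R R) (x : R) (L Φh Φhinv : Op R) (p : ℤ) : Op R :=
  if 2 ≤ p then
    ∑ j ∈ Finset.range p.toNat, ((2 * (j : ℚ) - (p : ℚ) + 1) / 2) •
      mul D (mul D (ofFn (Lv D x L Φh (p.toNat - 1 - j))) (dpow (-1))) (ofFn (Lw D x L Φhinv j))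
  else 0

/-- The right-hand side `[-(1/n) (M P^(np+1))_- + Y_p, L]` of the flow `∂L/∂s̃_p`,
where `L = P^n`. -/
noncomputable def anpFlow (D : Derivation ℚ R R) (x : R) (t : ℕ → Fn R) (n : ℕ)
    (Φ Φinv Φh Φhinv : Op R) (p : ℤ) : Op R :=
  comm D
    (-((1 / (n : ℚ)) • neg (mul D (opM D t Φ Φinv) (Ppow D Φ Φinv (n * p + 1)))) +
      opY D x (Ppow D Φ Φinv n) Φh Φhinv p)
    (Ppow D Φ Φinv n)

/-- A derivation of the complete graded algebra that commutes with `∂`: the action `∂/∂s` of an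
evolutionary flow on functions.  It acts on operators coefficientwise, by `opMap`. -/
structure IsEvolution (𝒜 : ℤ → Submodule ℚ R) (D : Derivation ℚ R R) (δ : Fn R → Fn R) :
    Prop where
  mem : ∀ g, IsFn 𝒜 g → IsFn 𝒜 (δ g)
  add : ∀ g h, IsFn 𝒜 g → IsFn 𝒜 h → δ (g + h) = δ g + δ h
  leibniz : ∀ g h, IsFn 𝒜 g → IsFn 𝒜 h → δ (fnMul g h) = fnMul (δ g) h + fnMul g (δ h)
  comm : ∀ g, IsFn 𝒜 g → δ (fnDer D g) = fnDer D (δ g)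

/-- The coefficientwise action of `δ` on operators. -/
def opMap (δ : Fn R → Fn R) (X : Op R) : Op R := fun i => δ (X i)

end

end CKP

namespace CKP

open Function
open scoped Pointwise

/-! Write `A` for Φ̂ and `B` for its inverse. Everything rests on one identity, `opY_eq`: Y_p is
minus the negative part of M̂ P̂^(p-1) + (1-p)/2 P̂^p. By linearity of the negative part, both
commutators are then taken with the same operator.

Conjugation turns M̂ P̂^(p-1) + (1-p)/2 P̂^p into A K B with K = x ∂^(1-p) + (1-p)/2 ∂^(-p). Since L
= P̂ = A ∂^(-1) B, one has L^k A = A ∂^(-k) and B L^k = ∂^(-k) B, so the functions in Y_p are (A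
∂^(-k))(1) and (-1)^k (B^* ∂^(-k))(1). Expanding A = ∑ α_a ∂^a and B = ∑ (-1)^b ∂^b β_b, with β_b
the coefficients of B^*, makes the claim bilinear in the α_a and β_b. What remains is a statement
about divided powers of x and ∂^(-1), `kernelSum_add_mem_nonneg`. It follows from the operator form
of Cauchy's formula for repeated integration, `sum_xpow_dp_xpow`, in which ∂^(-M-1) has kernel
(x-y)^M/M!, and from a weighted version, `sum_sub_xpow_dp_xpow`. Terms with a + b ≥ p are
differential operators, so A and B may be truncated at order p (`sum_value_add_mem_nonneg`).

For the evolution statement, the Leibniz rule and δ'Φ = -(S'_p)_- Φ give δ'Φ⁻¹ = Φ⁻¹ (S'_p)_-, hence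
the commutator formula for δ'L (`opMap_Ppow`). This takes place in 𝒟⁻, whereas S'_p mixes 𝒟⁻ with
𝒟⁺; only its negative part is known to lie in 𝒟⁻.

Associativity and the rules for adjoints are needed in both 𝒟⁻ and 𝒟⁺. They are proved once, as for
Hahn series, for operators whose support is well ordered under a suitable order on bidegrees. -/

/-! ### Well-ordered sets of bidegrees. -/

/-- A linear order on bidegrees `(i, j)` (order in `∂`, degree of the coefficient), for which each
derivation of a coefficient raises the bidegree. -/
structure Weight where
  hom : ℤ × ℤ →+ ℤ ×ₗ ℤ
  inj : Injective hom
  pos : 0 < hom (-1, 1)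

/-- The bidegrees in which an operator is nonzero. -/
def opSupp {R : Type*} [Zero R] (X : Op R) : Set (ℤ × ℤ) := {p | X p.1 p.2 ≠ 0}

namespace Weight

variable (w : Weight)

/-- The weights of the bidegree shifts caused by repeated derivation. -/
def shifts : Set (ℤ ×ₗ ℤ) := Set.range fun r : ℕ => w.hom (-(r : ℤ), (r : ℤ))

theorem hom_shift (r : ℕ) : w.hom (-(r : ℤ), (r : ℤ)) = r • w.hom (-1, 1) := by
  rw [← map_nsmul]; simp

theorem shifts_isPWO : w.shifts.IsPWO := by
  have : w.shifts = (fun r : ℕ => w.hom (-(r : ℤ), (r : ℤ))) '' Set.univ := by simp [shifts]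
  rw [this]
  refine (Set.isPWO_of_wellQuasiOrderedLE _).image_of_monotone fun a b hab => ?_
  simp only [hom_shift]
  exact nsmul_le_nsmul_left w.pos.le hab

theorem shift_mem (r : ℕ) : w.hom (-(r : ℤ), (r : ℤ)) ∈ w.shifts := ⟨r, rfl⟩

theorem shift_injective : Injective fun r : ℕ => w.hom (-(r : ℤ), (r : ℤ)) := by
  intro a b h
  have := w.inj h
  simpa using congrArg Prod.snd this

end Weight

/-- The finiteness behind multiplication of Hahn series. The map `f` lets it bound either a bidegree
or a number of derivations. -/
theorem finite_decomp {S T : Set (ℤ ×ₗ ℤ)} (hS : S.IsPWO) (hT : T.IsPWO) (γ : ℤ ×ₗ ℤ) {α : Type*}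
    (f : α → ℤ ×ₗ ℤ) (hf : Injective f) : {p : α | f p ∈ S ∧ γ - f p ∈ T}.Finite := by
  refine Set.Finite.of_injOn (f := fun p => (f p, γ - f p)) (t := S.antidiagonal T γ) ?_ ?_
    (Set.AddAntidiagonal.finite_of_isPWO hS hT γ)
  · rintro p ⟨h1, h2⟩
    exact ⟨h1, h2, by simp⟩
  · intro p _ q _ h
    exact hf (congrArg Prod.fst h)

/-! ### Products of operators with well-ordered support. -/

section

variable {R : Type*} [CommRing R] [Algebra ℚ R]

/-- Operators with well-ordered support. -/
def wf (R : Type*) [CommRing R] [Algebra ℚ R] (w : Weight) : Submodule ℚ (Op R) where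
  carrier := {X | (w.hom '' opSupp X).IsPWO}
  zero_mem' := by simp [opSupp]
  add_mem' {X Y} hX hY := by
    refine (hX.union hY).mono ?_
    rw [← Set.image_union]
    refine Set.image_mono fun p hp => ?_
    by_contra h
    simp only [opSupp, Set.mem_union, Set.mem_ofPred_eq, not_or, not_not] at h
    exact hp (by simp [h.1, h.2])
  smul_mem' c X hX := by
    refine hX.mono (Set.image_mono fun p hp h => hp ?_)
    simp [h]

variable {w : Weight} {X X' Y Y' Z : Op R} (D : Derivation ℚ R R)

theorem wf_of_subset (hY : Y ∈ wf R w) (h : ∀ i j, X i j ≠ 0 → Y i j ≠ 0) : X ∈ wf R w :=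
  Set.IsPWO.mono hY (Set.image_mono fun p hp => h p.1 p.2 hp)

theorem mem_image_supp {i j : ℤ} (h : X i j ≠ 0) : w.hom (i, j) ∈ w.hom '' opSupp X :=
  ⟨(i, j), h, rfl⟩

theorem ne_zero_of_smul_mul_iterate {k : ℤ} {a b : R} {r : ℕ} (h : k • (a * D^[r] b) ≠ 0) :
    a ≠ 0 ∧ b ≠ 0 := by
  constructor <;> rintro rfl <;> simp [iterate_map_zero] at h

/-- The weight of the target is the sum of the weights of a bidegree of `X`, a bidegree of `Y` and a
shift. Splitting off the first bounds `(i, j)`, splitting off the last bounds `r`, and the bidegree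
in `Y` is then determined. -/
theorem mul_finite (hX : X ∈ wf R w) (hY : Y ∈ wf R w) (m d : ℤ) :
    (support fun q : ℤ × ℕ × ℤ => Ring.choose q.1 q.2.1 •
      (X q.1 q.2.2 * D^[q.2.1] (Y (m + q.2.1 - q.1) (d - q.2.1 - q.2.2)))).Finite := by
  have h1 := finite_decomp hX (Set.IsPWO.add hY w.shifts_isPWO) (w.hom (m, d)) w.hom w.inj
  have h2 := finite_decomp w.shifts_isPWO (Set.IsPWO.add hX hY) (w.hom (m, d)) _ w.shift_injective
  refine Set.Finite.of_injOn (f := fun q : ℤ × ℕ × ℤ => ((q.1, q.2.2), q.2.1)) ?_ ?_ (h1.prod h2)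
  · rintro ⟨i, r, j⟩ h
    obtain ⟨ha, hb⟩ := ne_zero_of_smul_mul_iterate D h
    refine ⟨⟨mem_image_supp ha, ?_⟩, w.shift_mem r, ?_⟩
    · refine ⟨_, mem_image_supp hb, _, w.shift_mem r, ?_⟩
      simp only [← map_add, ← map_sub]
      congr 1; ext <;> simp <;> ring
    · refine ⟨_, mem_image_supp ha, _, mem_image_supp hb, ?_⟩
      simp only [← map_add, ← map_sub]
      congr 1; ext <;> simp
  · rintro ⟨i, r, j⟩ _ ⟨i', r', j'⟩ _ h
    simp only [Prod.mk.injEq] at h ⊢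
    tauto

/-- The nonvanishing binomial coefficient is recorded because it is what closes differential
operators and functions under products. -/
theorem exists_of_mul_ne_zero {m d : ℤ} (h : mul D X Y m d ≠ 0) :
    ∃ i j : ℤ, ∃ r : ℕ, Ring.choose i r ≠ 0 ∧ X i j ≠ 0 ∧ Y (m + r - i) (d - r - j) ≠ 0 := by
  by_contra! hc
  refine h (finsum_eq_zero_of_forall_eq_zero fun q => ?_)
  by_contra h0
  obtain ⟨ha, hb⟩ := ne_zero_of_smul_mul_iterate D h0
  refine hb (hc _ _ _ (fun h => h0 (by rw [h, zero_smul])) ha)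

theorem mul_supp {S T : Set (ℤ ×ₗ ℤ)} (hX : ∀ i j, X i j ≠ 0 → w.hom (i, j) ∈ S)
    (hY : ∀ i j, Y i j ≠ 0 → w.hom (i, j) ∈ T) {m d : ℤ} (h : mul D X Y m d ≠ 0) :
    w.hom (m, d) ∈ S + (T + w.shifts) := by
  obtain ⟨i, j, r, _, ha, hb⟩ := exists_of_mul_ne_zero D h
  refine ⟨_, hX _ _ ha, _, ⟨_, hY _ _ hb, _, w.shift_mem r, rfl⟩, ?_⟩
  simp only [← map_add]
  congr 1; ext <;> simp <;> ring

theorem mul_mem_wf (hX : X ∈ wf R w) (hY : Y ∈ wf R w) : mul D X Y ∈ wf R w := by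
  refine (Set.IsPWO.add hX (Set.IsPWO.add hY w.shifts_isPWO)).mono ?_
  rintro _ ⟨p, hp, rfl⟩
  exact mul_supp D (fun _ _ => mem_image_supp) (fun _ _ => mem_image_supp) hp

theorem add_mul_of_wf (hX : X ∈ wf R w) (hX' : X' ∈ wf R w) (hY : Y ∈ wf R w) :
    mul D (X + X') Y = mul D X Y + mul D X' Y := by
  ext m d
  simp only [mul, Pi.add_apply]
  rw [← finsum_add_distrib (mul_finite D hX hY m d) (mul_finite D hX' hY m d)]
  simp [add_mul]

theorem mul_add_of_wf (hX : X ∈ wf R w) (hY : Y ∈ wf R w) (hY' : Y' ∈ wf R w) :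
    mul D X (Y + Y') = mul D X Y + mul D X Y' := by
  ext m d
  simp only [mul, Pi.add_apply]
  rw [← finsum_add_distrib (mul_finite D hX hY m d) (mul_finite D hX hY' m d)]
  simp [mul_add, iterate_map_add]

theorem iterate_map_rat_smul (c : ℚ) (a : R) (r : ℕ) : D^[r] (c • a) = c • D^[r] a := by
  induction r with
  | zero => rfl
  | succ r ih => rw [iterate_succ_apply', ih, D.map_smul, iterate_succ_apply']

theorem smul_mul_of_wf (c : ℚ) (hX : X ∈ wf R w) (hY : Y ∈ wf R w) :
    mul D (c • X) Y = c • mul D X Y := by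
  ext m d
  simp only [mul, Pi.smul_apply]
  rw [smul_finsum' c (mul_finite D hX hY m d)]
  simp only [smul_mul_assoc, smul_comm c]

theorem mul_smul_of_wf (c : ℚ) (hX : X ∈ wf R w) (hY : Y ∈ wf R w) :
    mul D X (c • Y) = c • mul D X Y := by
  ext m d
  simp only [mul, Pi.smul_apply]
  rw [smul_finsum' c (mul_finite D hX hY m d)]
  simp only [iterate_map_rat_smul, mul_smul_comm, smul_comm c]

/-- The operator `c ∂^i`, where `c` is given the degree `e`. -/
def mono (i e : ℤ) (c : R) : Op R := fun i' j => if i' = i ∧ j = e then c else 0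

theorem mono_mem_wf (i e : ℤ) (c : R) : mono i e c ∈ wf R w := by
  refine (Set.isPWO_singleton (w.hom (i, e))).mono ?_
  rintro _ ⟨⟨a, b⟩, hp, rfl⟩
  have : a = i ∧ b = e := by
    by_contra h
    exact hp (by simp [mono, h])
  simp [this]

theorem dpow_eq_mono (k : ℤ) : (dpow k : Op R) = mono k 0 1 := by
  ext i j
  by_cases h : i = k <;> simp [dpow, mono, homog, h]

theorem dpow_mem_wf (k : ℤ) : (dpow k : Op R) ∈ wf R w := by
  rw [dpow_eq_mono]; exact mono_mem_wf _ _ _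

theorem finsum_eq_of_injective {α β M : Type*} [AddCommMonoid M] {f : α → M} (g : β → α)
    (hg : Injective g) (h : ∀ a, f a ≠ 0 → a ∈ Set.range g) : ∑ᶠ a, f a = ∑ᶠ b, f (g b) := by
  rw [← finsum_mem_range hg]
  refine finsum_congr fun a => ?_
  by_cases ha : f a = 0
  · simp [ha]
  · rw [finsum_eq_single _ (h a ha) fun _ hx => absurd rfl hx]

theorem mono_mul_apply (i e : ℤ) (c : R) (m d : ℤ) : mul D (mono i e c) Y m d =
    ∑ᶠ r : ℕ, Ring.choose i r • (c * D^[r] (Y (m + r - i) (d - r - e))) := by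
  rw [mul, finsum_eq_of_injective (fun r : ℕ => (i, r, e))]
  · simp [mono]
  · intro a b h; simpa using h
  · rintro ⟨i', r, j⟩ h
    have h := (ne_zero_of_smul_mul_iterate D h).1
    simp only [mono, ne_eq, ite_eq_right_iff, Classical.not_imp] at h
    exact ⟨r, by simp [h.1.1, h.1.2]⟩

theorem dpow_mul_apply (k m d : ℤ) : mul D (dpow k) Y m d =
    ∑ᶠ r : ℕ, Ring.choose k r • D^[r] (Y (m + r - k) (d - r)) := by
  simp [dpow_eq_mono, mono_mul_apply]

theorem mul_mono_apply (i e : ℤ) (c : R) (m d : ℤ) : mul D X (mono i e c) m d =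
    ∑ᶠ r : ℕ, Ring.choose (m + r - i) r • (X (m + r - i) (d - r - e) * D^[r] c) := by
  rw [mul, finsum_eq_of_injective (fun r : ℕ => (m + r - i, r, d - r - e))]
  · simp [mono]
  · intro a b h; simp only [Prod.mk.injEq] at h; exact h.2.1
  · rintro ⟨i', r, j⟩ h
    have h := (ne_zero_of_smul_mul_iterate D h).2
    simp only [mono, ne_eq, ite_eq_right_iff, Classical.not_imp] at h
    refine ⟨r, ?_⟩
    simp only [Prod.mk.injEq, true_and]
    omega

theorem dpow_mul_finite (hY : Y ∈ wf R w) (k m d : ℤ) :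
    (support fun r : ℕ => Ring.choose k r • D^[r] (Y (m + r - k) (d - r))).Finite := by
  refine Set.Finite.of_injOn (f := fun r : ℕ => ((k, r, 0) : ℤ × ℕ × ℤ)) ?_ ?_
    (mul_finite D (dpow_mem_wf k) hY m d)
  · intro r h
    simpa [dpow, homog] using h
  · intro a _ b _ h; simpa using h

theorem iterate_map_one (r : ℕ) : D^[r + 1] (1 : R) = 0 := by
  rw [iterate_succ_apply]; simp [iterate_map_zero]

theorem mul_dpow_apply (k m d : ℤ) : mul D X (dpow k) m d = X (m - k) d := by
  rw [dpow_eq_mono, mul_mono_apply, finsum_eq_single _ 0]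
  · simp
  · intro r hr
    obtain ⟨r, rfl⟩ := Nat.exists_eq_succ_of_ne_zero hr
    simp [iterate_map_one]

theorem one_mul_of_op : mul D (dpow 0) Y = Y := by
  ext m d
  rw [dpow_mul_apply, finsum_eq_single _ 0]
  · simp
  · intro r hr
    simp [Ring.choose_zero_pos ℤ (Nat.pos_of_ne_zero hr)]

theorem mul_one_of_op : mul D X (dpow 0) = X := by
  ext m d
  simp [mul_dpow_apply]

theorem dpow_one_mul_apply (m d : ℤ) : mul D (dpow 1) Y m d = Y (m - 1) d + D (Y m (d - 1)) := by
  rw [dpow_mul_apply, finsum_eq_finsetSum_of_support_subset (s := Finset.range 2)]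
  · simp [Finset.sum_range_succ]
  · intro r hr
    by_contra h
    simp only [Finset.coe_range, Set.mem_Iio, not_lt] at h
    refine hr ?_
    have : Ring.choose (1 : ℤ) r = 0 := by
      have := Ring.choose_natCast (R := ℤ) 1 r
      rw [Nat.choose_eq_zero_of_lt (by omega)] at this
      exact_mod_cast this
    simp [this]

/-- Left multiplication by `X` in terms of left multiplication by the powers of `∂`. -/
theorem mul_apply_eq_finsum (hX : X ∈ wf R w) (hY : Y ∈ wf R w) (m d : ℤ) : mul D X Y m d =
    ∑ᶠ p : ℤ × ℤ, X p.1 p.2 * mul D (dpow p.1) Y m (d - p.2) := by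
  let e : (ℤ × ℤ) × ℕ ≃ ℤ × ℕ × ℤ :=
    ⟨fun q => (q.1.1, q.2, q.1.2), fun q => ((q.1, q.2.2), q.2.1), fun _ => rfl, fun _ => rfl⟩
  rw [mul, ← finsum_comp_equiv e, finsum_curry]
  · refine finsum_congr fun p => ?_
    rw [dpow_mul_apply, mul_finsum' _ _ (dpow_mul_finite D hY _ _ _)]
    refine finsum_congr fun r => ?_
    simp only [e, Equiv.coe_fn_mk, mul_smul_comm]
    rw [show d - r - p.2 = d - p.2 - r by ring]
  · exact (mul_finite D hX hY m d).preimage e.injective.injOn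

end

/-! ### Associativity. -/

section

variable {R : Type*} [CommRing R] [Algebra ℚ R]
variable {w : Weight} {X X' Y Y' Z : Op R} (D : Derivation ℚ R R)

/-- An additive functional vanishes on operators with well-ordered support if it vanishes on
monomials and only depends on coefficients whose weight has a well-ordered set of complements. -/
theorem eq_zero_of_mono {T : Op R → R} {S : Set (ℤ ×ₗ ℤ)} {γ : ℤ ×ₗ ℤ} (hS : S.IsPWO)
    (hadd : ∀ X ∈ wf R w, ∀ X' ∈ wf R w, T (X + X') = T X + T X')
    (hsupp : ∀ X ∈ wf R w, T X ≠ 0 → ∃ i j, X i j ≠ 0 ∧ γ - w.hom (i, j) ∈ S)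
    (hmono : ∀ i e c, T (mono i e c) = 0) (hX : X ∈ wf R w) : T X = 0 := by
  -- Only finitely many coefficients are visible to `T`; induction on a finite set containing them
  -- removes one monomial at a time.
  have key : ∀ F : Finset (ℤ × ℤ), ∀ X ∈ wf R w,
      (∀ i j, X i j ≠ 0 → γ - w.hom (i, j) ∈ S → (i, j) ∈ F) → T X = 0 := by
    intro F
    induction F using Finset.induction_on with
    | empty =>
      intro X hX h
      by_contra h0
      obtain ⟨i, j, h1, h2⟩ := hsupp X hX h0
      simpa using h i j h1 h2
    | insert p F _ ih =>
      intro X hX h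
      have h1 : X = mono p.1 p.2 (X p.1 p.2) + (X - mono p.1 p.2 (X p.1 p.2)) := by abel
      have h2 : X - mono p.1 p.2 (X p.1 p.2) ∈ wf R w := sub_mem hX (mono_mem_wf _ _ _)
      rw [h1, hadd _ (mono_mem_wf _ _ _) _ h2, hmono, zero_add]
      refine ih _ h2 fun i j hij hs => ?_
      have hne : ¬ (i = p.1 ∧ j = p.2) := by
        rintro ⟨rfl, rfl⟩
        exact hij (by simp [mono])
      have hX' : X i j ≠ 0 := by simpa [mono, hne] using hij
      refine (Finset.mem_insert.1 (h i j hX' hs)).resolve_left fun he => hne ?_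
      simp [← he]
  have hfin := finite_decomp hX hS γ w.hom w.inj
  refine key hfin.toFinset X hX fun i j hij hs => ?_
  rw [Set.Finite.mem_toFinset]
  exact ⟨mem_image_supp hij, hs⟩

theorem finsum_nat_succ {M : Type*} [AddCommMonoid M] {f : ℕ → M} (hf : (support f).Finite) :
    ∑ᶠ r, f r = f 0 + ∑ᶠ r, f (r + 1) := by
  obtain ⟨N, hN⟩ : ∃ N, ∀ r, N ≤ r → f r = 0 := by
    obtain ⟨N, hN⟩ := hf.bddAbove
    refine ⟨N + 1, fun r hr => ?_⟩
    by_contra h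
    have : r ≤ N := hN h
    omega
  rw [finsum_eq_finsetSum_of_support_subset (s := Finset.range (N + 1)),
    finsum_eq_finsetSum_of_support_subset (s := Finset.range N), Finset.sum_range_succ', add_comm]
  · intro r hr
    by_contra h
    simp only [Finset.coe_range, Set.mem_Iio, not_lt] at h
    exact hr (hN _ (by omega))
  · intro r hr
    by_contra h
    simp only [Finset.coe_range, Set.mem_Iio, not_lt] at h
    exact hr (hN _ (by omega))

/-- Pascal's rule with an integer upper index, the source of ∂ · ∂^k = ∂^(k+1). -/
theorem finsum_choose_succ (k : ℤ) {f : ℕ → R}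
    (hf : (support fun r => Ring.choose k r • f r).Finite)
    (hf' : (support fun r => Ring.choose k r • f (r + 1)).Finite)
    (hf1 : (support fun r => Ring.choose (k + 1) r • f r).Finite) :
    ∑ᶠ r, Ring.choose (k + 1) r • f r =
      ∑ᶠ r, Ring.choose k r • f r + ∑ᶠ r, Ring.choose k r • f (r + 1) := by
  rw [finsum_nat_succ hf1, finsum_nat_succ hf, add_assoc, ← finsum_add_distrib]
  · simp [Ring.choose_succ_succ, add_smul, add_comm]
  · exact hf.preimage (f := fun r => r + 1) (by intro a _ b _ h; simpa using h)
  · exact hf'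

theorem dpow_mul_finite' (hY : Y ∈ wf R w) (k m d : ℤ) : (support fun r : ℕ =>
    Ring.choose k r • D^[r + 1] (Y (m + (r + 1 : ℕ) - k) (d - (r + 1 : ℕ)))).Finite := by
  refine (dpow_mul_finite D hY k (m + 1) (d - 1)).subset fun r h h0 => h ?_
  have h0 : Ring.choose k r • D^[r] (Y (m + 1 + r - k) (d - 1 - r)) = 0 := h0
  have := congrArg D h0
  simp only [map_zsmul, ← iterate_succ_apply', map_zero] at this
  beta_reduce
  rw [show m + ((r + 1 : ℕ) : ℤ) - k = m + 1 + r - k by push_cast; ring,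
    show d - ((r + 1 : ℕ) : ℤ) = d - 1 - r by push_cast; ring]
  exact this

theorem dpow_succ_mul_apply (hY : Y ∈ wf R w) (k m d : ℤ) : mul D (dpow (k + 1)) Y m d =
    ∑ᶠ r : ℕ, Ring.choose k r • D^[r] (Y (m - 1 + r - k) (d - r)) +
      ∑ᶠ r : ℕ, Ring.choose k r • D^[r + 1] (Y (m + r - k) (d - 1 - r)) := by
  rw [dpow_mul_apply, finsum_choose_succ]
  · congr 2 <;> ext r <;> push_cast <;> ring_nf
  · convert dpow_mul_finite D hY k (m - 1) d using 6
    ring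
  · convert dpow_mul_finite' D hY k (m - 1) d using 6
    ring
  · exact dpow_mul_finite D hY (k + 1) m d

theorem dpow_one_mul_dpow_mul (hY : Y ∈ wf R w) (k : ℤ) :
    mul D (dpow 1) (mul D (dpow k) Y) = mul D (dpow (k + 1)) Y := by
  ext m d
  rw [dpow_succ_mul_apply D hY, dpow_one_mul_apply, dpow_mul_apply, dpow_mul_apply,
    map_finsum D (dpow_mul_finite D hY _ _ _)]
  simp only [map_zsmul, iterate_succ_apply']

theorem dpow_mul_dpow_one_mul (hY : Y ∈ wf R w) (k : ℤ) :
    mul D (dpow k) (mul D (dpow 1) Y) = mul D (dpow (k + 1)) Y := by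
  ext m d
  rw [dpow_succ_mul_apply D hY, dpow_mul_apply, ← finsum_add_distrib]
  · refine finsum_congr fun r => ?_
    rw [dpow_one_mul_apply, iterate_map_add, smul_add, iterate_succ_apply]
    ring_nf
  · exact dpow_mul_finite D hY _ _ _
  · have := dpow_mul_finite' D hY k (m - 1) d
    simp only [fun r : ℕ => show m - 1 + ((r + 1 : ℕ) : ℤ) - k = m + r - k by push_cast; ring,
      fun r : ℕ => show d - ((r + 1 : ℕ) : ℤ) = d - 1 - r by push_cast; ring] at this
    exact this

/-- Cancelling ∂ on the left is what carries inductions on `k` to negative powers. -/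
theorem dpow_one_mul_injective (hY : Y ∈ wf R w) (hY' : Y' ∈ wf R w)
    (h : mul D (dpow 1) Y = mul D (dpow 1) Y') : Y = Y' := by
  have := congrArg (mul D (dpow (-1))) h
  rw [dpow_mul_dpow_one_mul D hY, dpow_mul_dpow_one_mul D hY'] at this
  simpa [one_mul_of_op] using this

theorem mul_pair_finite (hX : X ∈ wf R w) {S : Set (ℤ ×ₗ ℤ)} (hS : S.IsPWO) (γ : ℤ ×ₗ ℤ)
    {f : ℤ × ℤ → R} (hf : ∀ p, f p ≠ 0 → X p.1 p.2 ≠ 0 ∧ γ - w.hom p ∈ S) :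
    (support f).Finite :=
  (finite_decomp hX hS γ w.hom w.inj).subset fun p hp =>
    ⟨mem_image_supp (hf p hp).1, (hf p hp).2⟩

theorem dpow_mul_supp {k m d : ℤ} (h : mul D (dpow k) Y m d ≠ 0) :
    w.hom (m - k, d) ∈ w.hom '' opSupp Y + w.shifts := by
  obtain ⟨i, j, r, _, ha, hb⟩ := exists_of_mul_ne_zero D h
  have hij : i = k ∧ j = 0 := by
    rw [dpow_eq_mono] at ha
    by_contra h
    exact ha (by simp [mono, h])
  obtain ⟨rfl, rfl⟩ := hij
  refine ⟨_, mem_image_supp hb, _, w.shift_mem r, ?_⟩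
  simp only [← map_add]
  congr 1; ext <;> simp <;> ring

/-- Derivation of the coefficients of an operator. -/
def coeffDer (X : Op R) : Op R := fun i j => D (X i (j - 1))

theorem coeffDer_mem_wf (hX : X ∈ wf R w) : coeffDer D X ∈ wf R w := by
  have : coeffDer D X = mul D (dpow 1) X - mul D X (dpow 1) := by
    ext m d
    simp [coeffDer, dpow_one_mul_apply, mul_dpow_apply]
  rw [this]
  exact sub_mem (mul_mem_wf D (dpow_mem_wf _) hX) (mul_mem_wf D hX (dpow_mem_wf _))

theorem dpow_one_mul_eq : mul D (dpow 1) X = mul D X (dpow 1) + coeffDer D X := by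
  ext m d
  simp [coeffDer, dpow_one_mul_apply, mul_dpow_apply]

theorem mul_apply_finite (hX : X ∈ wf R w) (hY : Y ∈ wf R w) (m d : ℤ) :
    (support fun p : ℤ × ℤ => X p.1 p.2 * mul D (dpow p.1) Y m (d - p.2)).Finite := by
  refine mul_pair_finite hX (Set.IsPWO.add hY w.shifts_isPWO) (w.hom (m, d)) fun p hp => ?_
  refine ⟨left_ne_zero_of_mul hp, ?_⟩
  have := dpow_mul_supp (w := w) D (right_ne_zero_of_mul hp)
  rwa [← map_sub]

/-- Write ∂Y = Y∂ + Y' with Y' the derivative of the coefficients; the claim becomes the Leibniz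
rule for each product of a coefficient of `Y` with one of ∂^i Z. -/
theorem dpow_one_mul_mul (hY : Y ∈ wf R w) (hZ : Z ∈ wf R w) :
    mul D (dpow 1) (mul D Y Z) = mul D (mul D (dpow 1) Y) Z := by
  have hY1 := mul_mem_wf D hY (dpow_mem_wf (w := w) 1)
  have hDY := coeffDer_mem_wf D hY
  ext m d
  rw [dpow_one_mul_eq D (X := Y), add_mul_of_wf D hY1 hDY hZ, dpow_one_mul_apply, Pi.add_apply,
    Pi.add_apply, mul_apply_eq_finsum D hY hZ, mul_apply_eq_finsum D hY hZ,
    mul_apply_eq_finsum D hY1 hZ, mul_apply_eq_finsum D hDY hZ,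
    map_finsum D (mul_apply_finite D hY hZ _ _)]
  have e1 : ∑ᶠ p : ℤ × ℤ, mul D Y (dpow 1) p.1 p.2 * mul D (dpow p.1) Z m (d - p.2) =
      ∑ᶠ p : ℤ × ℤ, (Y p.1 p.2 * mul D (dpow p.1) Z (m - 1) (d - p.2) +
        Y p.1 p.2 * D (mul D (dpow p.1) Z m (d - 1 - p.2))) := by
    rw [← finsum_comp_equiv ((Equiv.addRight (1 : ℤ)).prodCongr (Equiv.refl ℤ))]
    refine finsum_congr fun p => ?_
    simp only [Equiv.prodCongr_apply, Prod.map, Equiv.coe_addRight, Equiv.refl_apply,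
      mul_dpow_apply, add_sub_cancel_right, ← dpow_one_mul_dpow_mul D hZ, dpow_one_mul_apply]
    rw [mul_add, show d - p.2 - 1 = d - 1 - p.2 by ring]
  have e2 : ∑ᶠ p : ℤ × ℤ, coeffDer D Y p.1 p.2 * mul D (dpow p.1) Z m (d - p.2) =
      ∑ᶠ p : ℤ × ℤ, D (Y p.1 p.2) * mul D (dpow p.1) Z m (d - 1 - p.2) := by
    rw [← finsum_comp_equiv ((Equiv.refl ℤ).prodCongr (Equiv.addRight (1 : ℤ)))]
    refine finsum_congr fun p => ?_
    simp only [Equiv.prodCongr_apply, Prod.map, Equiv.coe_addRight, Equiv.refl_apply,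
      coeffDer, add_sub_cancel_right]
    rw [show d - (p.2 + 1) = d - 1 - p.2 by ring]
  have f1 := mul_apply_finite D hY hZ (m - 1) d
  have f0 := Set.IsPWO.add hZ w.shifts_isPWO
  have f2 : (support fun p : ℤ × ℤ =>
      Y p.1 p.2 * D (mul D (dpow p.1) Z m (d - 1 - p.2))).Finite := by
    refine mul_pair_finite hY f0 (w.hom (m, d - 1)) fun p hp => ⟨left_ne_zero_of_mul hp, ?_⟩
    have h := right_ne_zero_of_mul hp
    have := dpow_mul_supp (w := w) D (k := p.1) (m := m) (d := d - 1 - p.2)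
      fun h0 => h (by rw [h0, map_zero])
    rwa [← map_sub]
  have f3 : (support fun p : ℤ × ℤ =>
      D (Y p.1 p.2) * mul D (dpow p.1) Z m (d - 1 - p.2)).Finite := by
    refine mul_pair_finite hY f0 (w.hom (m, d - 1)) fun p hp => ⟨fun h => ?_, ?_⟩
    · exact left_ne_zero_of_mul hp (by rw [h, map_zero])
    · have := dpow_mul_supp (w := w) D (right_ne_zero_of_mul hp)
      rwa [← map_sub]
  rw [e1, e2, finsum_add_distrib f1 f2, add_assoc, ← finsum_add_distrib f2 f3]
  congr 1
  refine finsum_congr fun p => ?_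
  rw [Derivation.leibniz, smul_eq_mul, smul_eq_mul]
  ring

theorem dpow_mul_mul (hY : Y ∈ wf R w) (hZ : Z ∈ wf R w) (k : ℤ) :
    mul D (dpow k) (mul D Y Z) = mul D (mul D (dpow k) Y) Z := by
  have hYZ := mul_mem_wf D hY hZ
  have hk (k : ℤ) := mul_mem_wf D (dpow_mem_wf (w := w) k) hY
  induction k using Int.induction_on with
  | zero => simp [one_mul_of_op]
  | succ k ih =>
    rw [← dpow_one_mul_dpow_mul D hYZ, ih, dpow_one_mul_mul D (hk _) hZ,
      dpow_one_mul_dpow_mul D hY]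
  | pred k ih =>
    refine dpow_one_mul_injective D (mul_mem_wf D (dpow_mem_wf _) hYZ)
      (mul_mem_wf D (hk _) hZ) ?_
    rw [dpow_one_mul_dpow_mul D hYZ, dpow_one_mul_mul D (hk _) hZ, dpow_one_mul_dpow_mul D hY]
    simpa using ih

theorem mono_mul_apply' (hY : Y ∈ wf R w) (i e : ℤ) (c : R) (m d : ℤ) :
    mul D (mono i e c) Y m d = c * mul D (dpow i) Y m (d - e) := by
  rw [mono_mul_apply, dpow_mul_apply, mul_finsum' _ _ (dpow_mul_finite D hY _ _ _)]
  refine finsum_congr fun r => ?_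
  rw [mul_smul_comm, show d - r - e = d - e - r by ring]

theorem mono_mul_mul (hY : Y ∈ wf R w) (hZ : Z ∈ wf R w) (i e : ℤ) (c : R) :
    mul D (mul D (mono i e c) Y) Z = mul D (mono i e c) (mul D Y Z) := by
  have hiY := mul_mem_wf D (dpow_mem_wf (w := w) i) hY
  ext m d
  rw [mono_mul_apply' D (mul_mem_wf D hY hZ), dpow_mul_mul D hY hZ,
    mul_apply_eq_finsum D (mul_mem_wf D (mono_mem_wf _ _ _) hY) hZ, mul_apply_eq_finsum D hiY hZ,
    mul_finsum' _ _ (mul_apply_finite D hiY hZ _ _),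
    ← finsum_comp_equiv ((Equiv.refl ℤ).prodCongr (Equiv.addRight e))]
  refine finsum_congr fun p => ?_
  simp only [Equiv.prodCongr_apply, Prod.map, Equiv.coe_addRight, Equiv.refl_apply,
    mono_mul_apply' D hY, add_sub_cancel_right]
  rw [mul_assoc, show d - (p.2 + e) = d - e - p.2 by ring]

/-- Both sides are additive in `X`, and a fixed coefficient sees only finitely many coefficients of
`X`, so `X` may be taken to be a monomial c ∂^i. There `dpow_mul_mul` applies, since c merely
multiplies the coefficients. -/
theorem mul_assoc_of_wf (hX : X ∈ wf R w) (hY : Y ∈ wf R w) (hZ : Z ∈ wf R w) :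
    mul D (mul D X Y) Z = mul D X (mul D Y Z) := by
  ext m d
  rw [← sub_eq_zero]
  have hYZ := mul_mem_wf D hY hZ
  have hS : (w.hom '' opSupp Y + w.shifts + (w.hom '' opSupp Z + w.shifts) + w.shifts).IsPWO :=
    ((Set.IsPWO.add hY w.shifts_isPWO).add (Set.IsPWO.add hZ w.shifts_isPWO)).add w.shifts_isPWO
  have h0 : (0 : ℤ ×ₗ ℤ) ∈ w.shifts := ⟨0, map_zero w.hom⟩
  refine eq_zero_of_mono (w := w)
    (T := fun X => mul D (mul D X Y) Z m d - mul D X (mul D Y Z) m d) hS (γ := w.hom (m, d))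
    ?_ ?_ ?_ hX
  · intro X hX X' hX'
    simp only [add_mul_of_wf D hX hX' hY, add_mul_of_wf D hX hX' hYZ, Pi.add_apply,
      add_mul_of_wf D (mul_mem_wf D hX hY) (mul_mem_wf D hX' hY) hZ]
    ring
  · intro X hX h
    by_cases h1 : mul D (mul D X Y) Z m d = 0
    · have h2 : mul D X (mul D Y Z) m d ≠ 0 := by simpa [h1] using h
      obtain ⟨i, j, r, _, ha, hb⟩ := exists_of_mul_ne_zero D h2
      obtain ⟨i', j', s, _, hc, hd⟩ := exists_of_mul_ne_zero D hb
      refine ⟨i, j, ha, ?_⟩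
      refine ⟨_, ⟨_, ⟨_, mem_image_supp hc, _, w.shift_mem r, rfl⟩, _,
        ⟨_, mem_image_supp hd, _, w.shift_mem s, rfl⟩, rfl⟩, 0, h0, ?_⟩
      simp only [← map_add, ← map_sub, add_zero]
      congr 1; ext <;> simp <;> ring
    · obtain ⟨i, j, r, _, ha, hb⟩ := exists_of_mul_ne_zero D h1
      obtain ⟨i', j', s, _, hc, hd⟩ := exists_of_mul_ne_zero D ha
      refine ⟨i', j', hc, ?_⟩
      refine ⟨_, ⟨_, ⟨_, mem_image_supp hd, _, w.shift_mem s, rfl⟩, _,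
        ⟨_, mem_image_supp hb, _, w.shift_mem r, rfl⟩, rfl⟩, 0, h0, ?_⟩
      simp only [← map_add, ← map_sub, add_zero]
      congr 1; ext <;> simp <;> ring
  · intro i e c
    simp only [mono_mul_mul D hY hZ, sub_self]

/-- The ring of operators with well-ordered support. -/
def PDO (D : Derivation ℚ R R) (w : Weight) : Type _ := (fun _ => wf R w) D

namespace PDO

instance : AddCommGroup (PDO D w) := inferInstanceAs (AddCommGroup (wf R w))

instance : Module ℚ (PDO D w) := inferInstanceAs (Module ℚ (wf R w))

variable {D}

/-- The operator underlying an element of the ring. -/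
def op (A : PDO D w) : Op R := Subtype.val (p := (· ∈ wf R w)) A

/-- An operator with well-ordered support as an element of the ring. -/
def mk {D : Derivation ℚ R R} {w : Weight} (X : Op R) (hX : X ∈ wf R w) : PDO D w := ⟨X, hX⟩

theorem op_mem (A : PDO D w) : A.op ∈ wf R w := A.2

@[simp] theorem op_mk (hX : X ∈ wf R w) : (mk X hX : PDO D w).op = X := rfl

@[ext] theorem ext {A B : PDO D w} (h : A.op = B.op) : A = B := Subtype.ext h

@[simp] theorem op_add (A B : PDO D w) : (A + B).op = A.op + B.op := rfl

@[simp] theorem op_sub (A B : PDO D w) : (A - B).op = A.op - B.op := rfl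

@[simp] theorem op_zero : (0 : PDO D w).op = 0 := rfl

@[simp] theorem op_smul (c : ℚ) (A : PDO D w) : (c • A).op = c • A.op := rfl

/-- The derivation is a phantom parameter of the type so that the product can depend on it. -/
noncomputable instance : Mul (PDO D w) := ⟨fun A B => mk (mul D A.op B.op) (mul_mem_wf D A.op_mem B.op_mem)⟩

instance : One (PDO D w) := ⟨mk (dpow 0) (dpow_mem_wf 0)⟩

@[simp] theorem op_mul (A B : PDO D w) : (A * B).op = mul D A.op B.op := rfl

theorem op_one : (1 : PDO D w).op = dpow 0 := rfl

noncomputable instance : Ring (PDO D w) :=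
  { (inferInstance : AddCommGroup (PDO D w)) with
    mul_assoc := fun A B C => PDO.ext (mul_assoc_of_wf D A.op_mem B.op_mem C.op_mem)
    one_mul := fun A => PDO.ext (one_mul_of_op D)
    mul_one := fun A => PDO.ext (mul_one_of_op D)
    left_distrib := fun A B C => PDO.ext (mul_add_of_wf D A.op_mem B.op_mem C.op_mem)
    right_distrib := fun A B C => PDO.ext (add_mul_of_wf D A.op_mem B.op_mem C.op_mem)
    zero_mul := fun A => by
      have := add_mul_of_wf D (zero_mem _) (zero_mem _) A.op_mem
      exact PDO.ext (by simpa using this)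
    mul_zero := fun A => by
      have := mul_add_of_wf D A.op_mem (zero_mem _) (zero_mem _)
      exact PDO.ext (by simpa using this) }

noncomputable instance : Algebra ℚ (PDO D w) :=
  Algebra.ofModule (fun c A B => PDO.ext (smul_mul_of_wf D c A.op_mem B.op_mem))
    (fun c A B => PDO.ext (mul_smul_of_wf D c A.op_mem B.op_mem))

@[simp] theorem op_sum {ι : Type*} (s : Finset ι) (f : ι → PDO D w) :
    (∑ i ∈ s, f i).op = ∑ i ∈ s, (f i).op :=
  map_sum (⟨⟨op, rfl⟩, fun _ _ => rfl⟩ : PDO D w →+ Op R) f s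

end PDO

end

/-! ### The formal adjoint. -/

section

variable {R : Type*} [CommRing R] [Algebra ℚ R]
variable {w : Weight} {X X' Y Y' Z : Op R} (D : Derivation ℚ R R)

theorem exists_of_adj_ne_zero {m d : ℤ} (h : adj D X m d ≠ 0) :
    ∃ r : ℕ, Ring.choose (m + (r : ℤ)) r ≠ 0 ∧ X (m + r) (d - r) ≠ 0 := by
  by_contra! hc
  refine h (finsum_eq_zero_of_forall_eq_zero fun r => ?_)
  by_cases hr : Ring.choose (m + (r : ℤ)) r = 0
  · simp [hr]
  · simp [hc r hr, iterate_map_zero]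

theorem adj_mem_wf (hX : X ∈ wf R w) : adj D X ∈ wf R w := by
  refine (Set.IsPWO.add hX w.shifts_isPWO).mono ?_
  rintro _ ⟨⟨m, d⟩, hp, rfl⟩
  obtain ⟨r, _, hr⟩ := exists_of_adj_ne_zero D hp
  refine ⟨_, mem_image_supp hr, _, w.shift_mem r, ?_⟩
  simp only [← map_add]
  congr 1; ext <;> simp

/-- The coefficients of the adjoint as residues. -/
theorem adj_apply_eq (hX : X ∈ wf R w) (m d : ℤ) :
    adj D X m d = (m.negOnePow : ℤ) • mul D (dpow (-m - 1)) X (-1) d := by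
  rw [dpow_mul_apply, smul_finsum' _ (dpow_mul_finite D hX _ _ _)]
  refine finsum_congr fun r => ?_
  rw [smul_smul, show -m - 1 = -(m + 1) by ring, Ring.choose_neg, Int.negOnePow_add,
    show m + 1 + (r : ℤ) - 1 = m + r by ring, show -1 + (r : ℤ) - -(m + 1) = m + r by ring,
    Units.smul_def, smul_eq_mul, Units.val_mul, mul_assoc]

theorem adj_add (hX : X ∈ wf R w) (hY : Y ∈ wf R w) : adj D (X + Y) = adj D X + adj D Y := by
  ext m d
  simp only [adj_apply_eq D hX, adj_apply_eq D hY, adj_apply_eq D (add_mem hX hY), Pi.add_apply,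
    mul_add_of_wf D (dpow_mem_wf (w := w) _) hX hY, smul_add]

theorem adj_one : adj D (dpow 0) = (dpow 0 : Op R) := by
  ext m d
  rw [adj, finsum_eq_single _ 0]
  · by_cases hm : m = 0
    · simp [hm]
    · simp [dpow, hm]
  · intro r hr
    obtain ⟨r, rfl⟩ := Nat.exists_eq_succ_of_ne_zero hr
    have : D^[r + 1] ((dpow 0 : Op R) (m + (r + 1 : ℕ)) (d - (r + 1 : ℕ))) = 0 := by
      rw [dpow_eq_mono, mono]
      split_ifs
      · exact iterate_map_one D r
      · exact iterate_map_zero D _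
    rw [Nat.succ_eq_add_one, this, smul_zero]

/-- By `adj_apply_eq` the coefficient is a signed residue of ∂^(-m-1) ∂^k X, so the factor ∂^k only
shifts `m` and changes the sign. -/
theorem adj_dpow_mul (hX : X ∈ wf R w) (k : ℤ) :
    adj D (mul D (dpow k) X) = (k.negOnePow : ℤ) • mul D (adj D X) (dpow k) := by
  ext m d
  have h : mul D (dpow (-m - 1)) (mul D (dpow k) X) = mul D (dpow (-(m - k) - 1)) X := by
    rw [dpow_mul_mul D (dpow_mem_wf (w := w) k) hX]
    congr 1
    ext i j
    rw [mul_dpow_apply]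
    simp only [dpow]
    have : i - k = -m - 1 ↔ i = -(m - k) - 1 := by omega
    simp only [this]
  rw [adj_apply_eq D (mul_mem_wf D (dpow_mem_wf k) hX), h, Pi.smul_apply, Pi.smul_apply,
    mul_dpow_apply, adj_apply_eq D hX, smul_smul, ← Units.val_mul, ← Int.negOnePow_add]
  congr 4
  ring

theorem dpow_mul_mono_apply (k e : ℤ) (c : R) (r : ℕ) :
    mul D (dpow k) (mono 0 e c) (k - r) (e + r) = Ring.choose k r • D^[r] c := by
  rw [mul_mono_apply, finsum_eq_single _ r]
  · simp [dpow, homog]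
  · intro s hs
    have : ¬ k - (r : ℤ) + s = k := by omega
    simp [dpow, this]

theorem exists_of_dpow_mul_mono_ne_zero {k e : ℤ} {c : R} {i j : ℤ}
    (h : mul D (dpow k) (mono 0 e c) i j ≠ 0) : ∃ r : ℕ, i = k - r ∧ j = e + r := by
  obtain ⟨i', j', r, _, ha, hb⟩ := exists_of_mul_ne_zero D h
  rw [dpow_eq_mono] at ha
  simp only [mono, ne_eq, ite_eq_right_iff, Classical.not_imp] at ha hb
  exact ⟨r, by omega, by omega⟩

/-- Expanding the residue of ∂^(-m-1) c X gives the coefficients of X^* c, by negating the upper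
index of the binomials. -/
theorem adj_mono_mul (hX : X ∈ wf R w) (e : ℤ) (c : R) :
    adj D (mul D (mono 0 e c) X) = mul D (adj D X) (mono 0 e c) := by
  ext m d
  have hc := mono_mem_wf (w := w) 0 e c
  rw [adj_apply_eq D (mul_mem_wf D hc hX), dpow_mul_mul D hc hX,
    mul_apply_eq_finsum D (mul_mem_wf D (dpow_mem_wf _) hc) hX, mul_mono_apply,
    smul_finsum' _ (mul_apply_finite D (mul_mem_wf D (dpow_mem_wf _) hc) hX _ _),
    finsum_eq_of_injective (fun r : ℕ => (-m - 1 - (r : ℤ), e + (r : ℤ)))]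
  · refine finsum_congr fun r => ?_
    rw [dpow_mul_mono_apply, adj_apply_eq D hX, show -m - 1 = -(m + 1) by ring, Ring.choose_neg,
      show m + 1 + (r : ℤ) - 1 = m + r by ring, show m + (r : ℤ) - 0 = m + r by ring,
      show -(m + r) - 1 = -(m + 1) - (r : ℤ) by ring, show d - (e + r) = d - r - e by ring,
      Int.negOnePow_add]
    simp only [Units.smul_def, zsmul_eq_mul, smul_eq_mul]
    push_cast
    ring
  · intro a b h
    simp only [Prod.mk.injEq] at h
    omega
  · rintro ⟨i, j⟩ h
    have h1 : mul D (dpow (-m - 1)) (mono 0 e c) i j ≠ 0 := fun h0 => h (by simp [h0])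
    obtain ⟨r, rfl, rfl⟩ := exists_of_dpow_mul_mono_ne_zero D h1
    exact ⟨r, rfl⟩

namespace PDO

/-- The operator `∂^k`. -/
def dp (D : Derivation ℚ R R) (w : Weight) (k : ℤ) : PDO D w := mk (dpow k) (dpow_mem_wf k)

/-- Multiplication by the function `c`, where `c` is given the degree `e`. -/
def fn (D : Derivation ℚ R R) (w : Weight) (e : ℤ) (c : R) : PDO D w :=
  mk (mono 0 e c) (mono_mem_wf 0 e c)

variable {D}

@[simp] theorem op_dp (k : ℤ) : (dp D w k).op = dpow k := rfl

@[simp] theorem op_fn (e : ℤ) (c : R) : (fn D w e c).op = mono 0 e c := rfl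

theorem dp_zero : dp D w 0 = 1 := rfl

theorem dp_mul_dp (i j : ℤ) : dp D w i * dp D w j = dp D w (i + j) := by
  ext m d
  simp only [op_mul, op_dp, mul_dpow_apply, dpow, sub_eq_iff_eq_add]

theorem op_mul_dp (A : PDO D w) (k m d : ℤ) : (A * dp D w k).op m d = A.op (m - k) d := by
  simp [mul_dpow_apply]

theorem mono_eq (i e : ℤ) (c : R) : mono i e c = (fn D w e c * dp D w i).op := by
  ext m d
  simp only [op_mul_dp, op_fn, mono, sub_eq_zero]

/-- The formal adjoint on the ring of operators. -/
noncomputable def adj : PDO D w →+ PDO D w where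
  toFun A := mk (CKP.adj D A.op) (adj_mem_wf D A.op_mem)
  map_zero' := by
    ext m d
    simp [CKP.adj, iterate_map_zero]
  map_add' A B := PDO.ext (adj_add D A.op_mem B.op_mem)

@[simp] theorem op_adj (A : PDO D w) : (adj A).op = CKP.adj D A.op := rfl

theorem adj_dp_mul (k : ℤ) (A : PDO D w) :
    adj (dp D w k * A) = (k.negOnePow : ℤ) • (adj A * dp D w k) := by
  refine PDO.ext ?_
  have h : ∀ (c : ℤ) (B : PDO D w), (c • B).op = c • B.op := fun c B =>
    map_zsmul (⟨⟨op, rfl⟩, fun _ _ => rfl⟩ : PDO D w →+ Op R) c B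
  rw [h]
  exact adj_dpow_mul D A.op_mem k

theorem adj_fn_mul (e : ℤ) (c : R) (A : PDO D w) : adj (fn D w e c * A) = adj A * fn D w e c :=
  PDO.ext (adj_mono_mul D A.op_mem e c)

@[simp] theorem adj_one : adj (1 : PDO D w) = 1 := PDO.ext (CKP.adj_one D)

theorem adj_fn (e : ℤ) (c : R) : adj (fn D w e c) = fn D w e c := by
  simpa using adj_fn_mul e c (1 : PDO D w)

theorem adj_dp (k : ℤ) : adj (dp D w k) = (k.negOnePow : ℤ) • dp D w k := by
  simpa using adj_dp_mul k (1 : PDO D w)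

/-- Reduction to a monomial in the left factor, where the function and the power of ∂ are moved
across one after the other. -/
theorem adj_mul (A B : PDO D w) : adj (A * B) = adj B * adj A := by
  ext m d
  rw [← sub_eq_zero]
  obtain ⟨X, hX⟩ := A
  obtain ⟨Y, hY⟩ := B
  have hB := adj_mem_wf D hY
  have hS : (w.hom '' opSupp Y + w.shifts + w.shifts + w.shifts).IsPWO :=
    ((Set.IsPWO.add hY w.shifts_isPWO).add w.shifts_isPWO).add w.shifts_isPWO
  have h0 : (0 : ℤ ×ₗ ℤ) ∈ w.shifts := ⟨0, map_zero w.hom⟩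
  refine eq_zero_of_mono (w := w)
    (T := fun X => CKP.adj D (mul D X Y) m d - mul D (CKP.adj D Y) (CKP.adj D X) m d) hS
    (γ := w.hom (m, d)) ?_ ?_ ?_ hX
  · intro X hX X' hX'
    simp only [add_mul_of_wf D hX hX' hY, adj_add D (mul_mem_wf D hX hY) (mul_mem_wf D hX' hY),
      adj_add D hX hX', mul_add_of_wf D hB (adj_mem_wf D hX) (adj_mem_wf D hX'), Pi.add_apply]
    ring
  · intro X hX h
    by_cases h1 : CKP.adj D (mul D X Y) m d = 0
    · have h2 : mul D (CKP.adj D Y) (CKP.adj D X) m d ≠ 0 := by simpa [h1] using h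
      obtain ⟨i, j, r, _, ha, hb⟩ := exists_of_mul_ne_zero D h2
      obtain ⟨s, _, ha⟩ := exists_of_adj_ne_zero D ha
      obtain ⟨u, _, hb⟩ := exists_of_adj_ne_zero D hb
      refine ⟨_, _, hb, ?_⟩
      refine ⟨_, ⟨_, ⟨_, mem_image_supp ha, _, w.shift_mem s, rfl⟩, _, w.shift_mem u, rfl⟩, _,
        w.shift_mem r, ?_⟩
      simp only [← map_add, ← map_sub]
      congr 1; ext <;> simp <;> ring
    · obtain ⟨s, _, ha⟩ := exists_of_adj_ne_zero D h1
      obtain ⟨i, j, r, _, ha, hb⟩ := exists_of_mul_ne_zero D ha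
      refine ⟨_, _, ha, ?_⟩
      refine ⟨_, ⟨_, ⟨_, mem_image_supp hb, _, w.shift_mem r, rfl⟩, _, w.shift_mem s, rfl⟩, 0, h0, ?_⟩
      simp only [← map_add, ← map_sub, add_zero]
      congr 1; ext <;> simp <;> ring
  · intro i e c
    have key : adj (fn D w e c * dp D w i * mk Y hY) =
        adj (mk Y hY) * adj (fn D w e c * dp D w i) := by
      rw [mul_assoc, adj_fn_mul, adj_fn_mul, adj_dp_mul, adj_dp]
      simp only [smul_mul_assoc, mul_smul_comm, mul_assoc]
    rw [sub_eq_zero, mono_eq (w := w) (D := D)]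
    exact congrFun (congrFun (congrArg op key) m) d

theorem adj_adj (A : PDO D w) : adj (adj A) = A := by
  ext m d
  rw [← sub_eq_zero]
  obtain ⟨X, hX⟩ := A
  have h0 : (0 : ℤ ×ₗ ℤ) ∈ w.shifts := ⟨0, map_zero w.hom⟩
  refine eq_zero_of_mono (w := w) (T := fun X => CKP.adj D (CKP.adj D X) m d - X m d)
    (Set.IsPWO.add w.shifts_isPWO w.shifts_isPWO) (γ := w.hom (m, d)) ?_ ?_ ?_ hX
  · intro X hX X' hX'
    simp only [adj_add D hX hX', adj_add D (adj_mem_wf D hX) (adj_mem_wf D hX'), Pi.add_apply]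
    ring
  · intro X hX h
    by_cases h1 : X m d = 0
    · have h2 : CKP.adj D (CKP.adj D X) m d ≠ 0 := by simpa [h1] using h
      obtain ⟨s, _, ha⟩ := exists_of_adj_ne_zero D h2
      obtain ⟨r, _, ha⟩ := exists_of_adj_ne_zero D ha
      refine ⟨_, _, ha, _, w.shift_mem r, _, w.shift_mem s, ?_⟩
      simp only [← map_add, ← map_sub]
      congr 1; ext <;> simp <;> ring
    · exact ⟨m, d, h1, 0, h0, 0, h0, by simp⟩
  · intro i e c
    have key : adj (adj (fn D w e c * dp D w i)) = fn D w e c * dp D w i := by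
      rw [adj_mul, adj_mul, adj_fn, adj_fn, adj_dp, map_zsmul, adj_dp, smul_smul,
        ← Units.val_mul, ← Int.negOnePow_add, Int.negOnePow_even _ (Even.add_self i)]
      simp
    rw [sub_eq_zero, mono_eq (w := w) (D := D)]
    exact congrFun (congrFun (congrArg op key) m) d

end PDO

end

/-! ### Differential operators and multiplication operators. -/

section

variable {R : Type*} [CommRing R] [Algebra ℚ R]
variable {w : Weight} {D : Derivation ℚ R R}

theorem negOnePow_zsmul {M : Type*} [AddCommGroup M] [Module ℚ M] (n : ℕ) (A : M) :
    ((n : ℤ).negOnePow : ℤ) • A = (-1 : ℚ) ^ n • A := by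
  rcases Nat.even_or_odd n with h | h
  · rw [Int.negOnePow_even _ ((Int.even_coe_nat n).2 h), h.neg_one_pow]; simp
  · rw [Int.negOnePow_odd _ ((Int.odd_coe_nat n).2 h), h.neg_one_pow]; simp

namespace PDO

/-- Operators without negative powers of `∂`. -/
def nonneg (D : Derivation ℚ R R) (w : Weight) : Subalgebra ℚ (PDO D w) where
  carrier := {A | ∀ i < 0, A.op i = 0}
  add_mem' {A B} hA hB i hi := by simp [hA i hi, hB i hi]
  mul_mem' {A B} hA hB m hm := by
    ext d
    by_contra h
    obtain ⟨i, j, r, hc, ha, hb⟩ := exists_of_mul_ne_zero D h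
    have hi : 0 ≤ i := by
      by_contra hi
      exact ha (by rw [hA i (by omega)]; rfl)
    have hr : 0 ≤ m + r - i := by
      by_contra hr
      exact hb (by rw [hB _ (by omega)]; rfl)
    -- Here `0 ≤ i < r`, so the binomial coefficient vanishes: derivations never lower the order
    -- below zero.
    lift i to ℕ using hi
    refine hc ?_
    rw [Ring.choose_natCast, Nat.choose_eq_zero_of_lt (by omega), Nat.cast_zero]
  algebraMap_mem' c i hi := by
    rw [Algebra.algebraMap_eq_smul_one]
    ext j
    simp [op_one, dpow, hi.ne]

theorem mem_nonneg {A : PDO D w} : A ∈ nonneg D w ↔ ∀ i < 0, A.op i = 0 := Iff.rfl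

theorem dp_mem_nonneg {k : ℤ} (hk : 0 ≤ k) : dp D w k ∈ nonneg D w := by
  intro i hi
  have : i ≠ k := by omega
  simp [dpow, this]

theorem adj_mem_nonneg {A : PDO D w} (hA : A ∈ nonneg D w) : adj A ∈ nonneg D w := by
  intro m hm
  ext d
  by_contra h
  obtain ⟨r, hc, ha⟩ := exists_of_adj_ne_zero D h
  obtain ⟨i, hi⟩ : ∃ i : ℕ, m + r = i := by
    refine Int.eq_ofNat_of_zero_le ?_
    by_contra hi
    exact ha (by rw [hA _ (by omega)]; rfl)
  refine hc ?_
  rw [hi, Ring.choose_natCast, Nat.choose_eq_zero_of_lt (by omega), Nat.cast_zero]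

/-- Multiplication operators by functions. -/
def functions (D : Derivation ℚ R R) (w : Weight) : Subalgebra ℚ (PDO D w) where
  carrier := {A | ∀ i ≠ 0, A.op i = 0}
  add_mem' {A B} hA hB i hi := by simp [hA i hi, hB i hi]
  mul_mem' {A B} hA hB m hm := by
    ext d
    by_contra h
    obtain ⟨i, j, r, hc, ha, hb⟩ := exists_of_mul_ne_zero D h
    have hi : i = 0 := by
      by_contra hi
      exact ha (by rw [hA i hi]; rfl)
    subst hi
    have hr : r = 0 := by
      by_contra hr
      exact hc (Ring.choose_zero_pos ℤ (Nat.pos_of_ne_zero hr))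
    subst hr
    exact hb (by rw [hB _ (by simpa using hm)]; rfl)
  algebraMap_mem' c i hi := by
    rw [Algebra.algebraMap_eq_smul_one]
    ext j
    simp [op_one, dpow, hi]

theorem fn_mem_functions (e : ℤ) (c : R) : fn D w e c ∈ functions D w := by
  intro i hi
  ext j
  simp [mono, hi]

theorem functions_le_nonneg {A : PDO D w} (hA : A ∈ functions D w) : A ∈ nonneg D w :=
  fun i hi => hA i hi.ne

theorem functions_op_mul_zero {A B : PDO D w} (hA : A ∈ functions D w) (d : ℤ) :
    (A * B).op 0 d = ∑ᶠ j, A.op 0 j * B.op 0 (d - j) := by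
  rw [op_mul, mul_apply_eq_finsum D A.op_mem B.op_mem,
    finsum_eq_of_injective (fun j : ℤ => ((0 : ℤ), j))]
  · simp [one_mul_of_op]
  · intro a b h; simpa using h
  · rintro ⟨i, j⟩ h
    have hi : i = 0 := by
      by_contra hi
      exact left_ne_zero_of_mul h (by simp [hA i hi])
    exact ⟨j, by simp [hi]⟩

theorem functions_ext {A B : PDO D w} (hA : A ∈ functions D w) (hB : B ∈ functions D w)
    (h : A.op 0 = B.op 0) : A = B := by
  refine PDO.ext (funext fun i => ?_)
  by_cases hi : i = 0
  · rw [hi, h]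
  · rw [hA i hi, hB i hi]

theorem functions_mul_comm {A B : PDO D w} (hA : A ∈ functions D w) (hB : B ∈ functions D w) :
    A * B = B * A := by
  refine functions_ext (mul_mem hA hB) (mul_mem hB hA) (funext fun d => ?_)
  rw [functions_op_mul_zero hA, functions_op_mul_zero hB, ← finsum_comp_equiv (Equiv.subLeft d)]
  refine finsum_congr fun j => ?_
  simp [mul_comm]

theorem adj_of_functions {A : PDO D w} (hA : A ∈ functions D w) : adj A = A := by
  ext m d
  rw [op_adj, CKP.adj, finsum_eq_single _ 0]
  · by_cases hm : m = 0
    · simp [hm]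
    · simp [hA m hm]
  · intro r hr
    by_cases hm : m + r = 0
    · rw [hm, Ring.choose_zero_pos ℤ (Nat.pos_of_ne_zero hr)]; simp
    · rw [hA _ hm]; simp [iterate_map_zero]

theorem ofFn_mem_wf (A : PDO D w) (a : ℤ) : ofFn (A.op a) ∈ wf R w := by
  refine wf_of_subset (A * dp D w (-a)).op_mem fun i j h => ?_
  by_cases hi : i = 0
  · subst hi
    rw [op_mul_dp]
    simpa [ofFn] using h
  · simp [ofFn, hi] at h

/-- The coefficient of `∂^a` in an operator. -/
def coeff (A : PDO D w) (a : ℤ) : PDO D w := mk (ofFn (A.op a)) (ofFn_mem_wf A a)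

theorem coeff_mem_functions (A : PDO D w) (a : ℤ) : coeff A a ∈ functions D w := by
  intro i hi
  simp [coeff, ofFn, hi]

/-- Truncation at order `q`: the operators may have infinitely many terms, but the tail is divisible
on the right by ∂^q. -/
theorem exists_eq_sum_coeff {A : PDO D w} (hA : A ∈ nonneg D w) (q : ℕ) :
    ∃ B ∈ nonneg D w, A = ∑ a ∈ Finset.range q, coeff A a * dp D w a + B * dp D w q := by
  refine ⟨(A - ∑ a ∈ Finset.range q, coeff A a * dp D w a) * dp D w (-q), ?_, ?_⟩
  · intro i hi
    ext j
    rw [op_mul_dp, op_sub, op_sum]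
    simp only [Pi.sub_apply, Finset.sum_apply, op_mul_dp, coeff, op_mk, ofFn, sub_neg_eq_add,
      Pi.zero_apply]
    by_cases h : 0 ≤ i + q
    · obtain ⟨b, hb⟩ := Int.eq_ofNat_of_zero_le h
      rw [Finset.sum_eq_single b]
      · simp [hb]
      · intro c _ hc
        rw [if_neg (by omega)]; rfl
      · intro hb'
        rw [Finset.mem_range] at hb'
        omega
    · rw [hA _ (by omega), Finset.sum_eq_zero]
      · simp
      · intro c _
        rw [if_neg (by omega)]; rfl
  · rw [mul_assoc, dp_mul_dp]
    simp [dp_zero]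

/-! ### Divided powers of x and the kernels of negative powers of ∂. -/

/-- The divided power `x^l / l!` of the independent variable. -/
noncomputable def xpow (D : Derivation ℚ R R) (w : Weight) (x : R) (l : ℕ) : PDO D w :=
  fn D w (-l) ((l.factorial : ℚ)⁻¹ • x ^ l)

theorem xpow_mem_functions (x : R) (l : ℕ) : xpow D w x l ∈ functions D w := fn_mem_functions _ _

/-- Without negative powers in `A`, only ∂^(-l) with `l ≤ k` occur in A ∂^(-k), and ∂^(a-k)(1) is a
divided power of x. -/
theorem ofFn_applyOne (x : R) {A : PDO D w} (hA : A ∈ nonneg D w) (k : ℕ) :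
    ofFn (applyOne x (A * dp D w (-k)).op) =
      (∑ a ∈ Finset.range (k + 1), coeff A a * xpow D w x (k - a)).op := by
  have hmem : ∑ a ∈ Finset.range (k + 1), coeff A a * xpow D w x (k - a) ∈ functions D w :=
    sum_mem fun a _ => mul_mem (coeff_mem_functions A a) (xpow_mem_functions x _)
  ext m d
  by_cases hm : m = 0
  · subst hm
    have h1 : applyOne x (A * dp D w (-k)).op d = ∑ l ∈ Finset.range (k + 1),
        ((l.factorial : ℚ)⁻¹) • (A.op (k - l) (d + l) * x ^ l) := by
      rw [applyOne, finsum_eq_finsetSum_of_support_subset (s := Finset.range (k + 1))]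
      · refine Finset.sum_congr rfl fun l _ => ?_
        rw [op_mul_dp, show -(l : ℤ) - -(k : ℤ) = k - l by ring]
      · intro l hl
        by_contra h
        simp only [Finset.coe_range, Set.mem_Iio, not_lt] at h
        refine hl ?_
        beta_reduce
        rw [op_mul_dp, hA _ (by omega)]
        simp
    simp only [ofFn, if_true, op_sum, Finset.sum_apply]
    rw [h1, ← Finset.sum_range_reflect]
    refine Finset.sum_congr rfl fun a ha => ?_
    have ha : a ≤ k := by simpa [Nat.lt_succ_iff] using ha
    rw [xpow, op_mul, op_fn, mul_mono_apply, finsum_eq_single _ 0]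
    · rw [show k + 1 - 1 - a = k - a by omega, Nat.cast_sub ha]
      simp only [Nat.cast_zero, add_zero, sub_zero, iterate_zero_apply, Ring.choose_zero_right,
        one_smul, coeff, op_mk, ofFn, if_true, mul_smul_comm]
      rw [show d - -((k : ℤ) - a) = d + (k - a) by ring, show (k : ℤ) - (k - a) = a by ring]
    · intro r hr
      have : (coeff A a).op (0 + r - 0) = 0 := coeff_mem_functions A a _ (by simpa using hr)
      rw [this]; simp
  · rw [hmem m hm]
    simp [ofFn, hm]

theorem dp_one_mul_fn (e : ℤ) (c : R) :
    dp D w 1 * fn D w e c = fn D w e c * dp D w 1 + fn D w (e + 1) (D c) := by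
  refine PDO.ext ?_
  rw [op_mul, op_dp, dpow_one_mul_eq, op_add]
  congr 1
  ext i j
  simp only [coeffDer, op_fn, mono]
  by_cases h : i = 0 ∧ j - 1 = e
  · rw [if_pos h, if_pos ⟨h.1, by omega⟩]
  · rw [if_neg h, if_neg (by omega), map_zero]

theorem fn_mul_fn (e e' : ℤ) (c c' : R) : fn D w e c * fn D w e' c' = fn D w (e + e') (c * c') := by
  refine functions_ext (mul_mem (fn_mem_functions _ _) (fn_mem_functions _ _))
    (fn_mem_functions _ _) (funext fun d => ?_)
  rw [functions_op_mul_zero (fn_mem_functions _ _), finsum_eq_single _ e]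
  · simp only [op_fn, mono, true_and, if_true, mul_ite, mul_zero, sub_eq_iff_eq_add']
  · intro j hj
    simp [mono, hj]

theorem fn_zero (e : ℤ) : fn D w e (0 : R) = 0 := by
  ext i j
  simp [mono]

theorem fn_add (e : ℤ) (c c' : R) : fn D w e (c + c') = fn D w e c + fn D w e c' := by
  ext i j
  simp only [op_fn, mono, op_add, Pi.add_apply]
  split_ifs <;> simp

theorem fn_smul (e : ℤ) (q : ℚ) (c : R) : fn D w e (q • c) = q • fn D w e c := by
  ext i j
  simp only [op_fn, mono, op_smul, Pi.smul_apply]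
  split_ifs <;> simp

theorem xpow_zero (x : R) : xpow D w x 0 = 1 := by
  refine PDO.ext ?_
  simp [xpow, op_one, dpow_eq_mono]

theorem xpow_one (x : R) : xpow D w x 1 = fn D w (-1) x := by simp [xpow]

theorem dp_one_mul_xpow_succ {x : R} (hx : D x = 1) (l : ℕ) :
    dp D w 1 * xpow D w x (l + 1) = xpow D w x (l + 1) * dp D w 1 + xpow D w x l := by
  rw [xpow, dp_one_mul_fn, xpow]
  congr 2
  · push_cast; ring
  · rw [D.map_smul, D.leibniz_pow, hx, Nat.factorial_succ]
    simp only [Nat.add_sub_cancel, smul_eq_mul, mul_one, ← Nat.cast_smul_eq_nsmul ℚ, smul_smul]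
    congr 1
    push_cast
    field_simp

theorem succ_smul_xpow_succ (x : R) (l : ℕ) :
    ((l : ℚ) + 1) • xpow D w x (l + 1) = xpow D w x 1 * xpow D w x l := by
  rw [xpow_one, xpow, xpow, fn_mul_fn, ← fn_smul, smul_smul, Nat.factorial_succ]
  congr 1
  · push_cast; ring
  · rw [mul_smul_comm, pow_succ']
    congr 1
    push_cast
    field_simp

/-- The binomial theorem for (x - x)^(M+1): the kernel vanishes on the diagonal. -/
theorem sum_xpow_mul_xpow (x : R) (M : ℕ) :
    ∑ l ∈ Finset.HasAntidiagonal.antidiagonal (M + 1), (-1 : ℚ) ^ l.2 • (xpow D w x l.1 * xpow D w x l.2) = 0 := by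
  have h1 : ∀ l ∈ Finset.HasAntidiagonal.antidiagonal (M + 1),
      (-1 : ℚ) ^ l.2 • (xpow D w x l.1 * xpow D w x l.2) =
        fn D w (-(M + 1 : ℕ)) (((M + 1).factorial : ℚ)⁻¹ •
          ((M + 1).choose l.1 • (x ^ l.1 * (-x) ^ l.2))) := by
    intro l hl
    rw [Finset.HasAntidiagonal.mem_antidiagonal] at hl
    rw [xpow, xpow, fn_mul_fn, ← fn_smul, ← hl]
    congr 1
    · push_cast; ring
    · rw [smul_mul_smul_comm, ← Nat.cast_smul_eq_nsmul ℚ, smul_smul, smul_smul,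
        Nat.choose_symm_add, Nat.add_choose, Nat.cast_div (Nat.factorial_mul_factorial_dvd_factorial_add _ _)
          (by positivity), neg_pow x, show (-1 : R) ^ l.2 = algebraMap ℚ R ((-1) ^ l.2) by simp,
        ← Algebra.smul_def, mul_smul_comm, smul_smul]
      congr 1
      have := Nat.factorial_ne_zero (l.1 + l.2)
      push_cast
      field_simp
  have h2 : ∀ s : Finset (ℕ × ℕ), ∀ f : ℕ × ℕ → R, ∀ e : ℤ,
      ∑ l ∈ s, fn D w e (f l) = fn D w e (∑ l ∈ s, f l) := fun s f e =>
    (map_sum (⟨⟨fn D w e, fn_zero e⟩, fn_add e⟩ : R →+ PDO D w) f s).symm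
  rw [Finset.sum_congr rfl h1, h2, ← Finset.smul_sum,
    ← (Commute.all x (-x)).add_pow' (M + 1)]
  simp [fn_zero]

/-- The kernel `(x - y)^M / M!` represents `∂^(-M-1)`. -/
theorem sum_xpow_dp_xpow {x : R} (hx : D x = 1) (M : ℕ) :
    ∑ l ∈ Finset.HasAntidiagonal.antidiagonal M, (-1 : ℚ) ^ l.2 • (xpow D w x l.1 * dp D w (-1) * xpow D w x l.2) =
      dp D w (-M - 1) := by
  induction M with
  | zero => simp [xpow_zero]
  | succ M ih =>
    have hd : dp D w 1 * dp D w (-1) = 1 := by rw [dp_mul_dp]; exact dp_zero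
    have hd' : dp D w (-1) * dp D w 1 = 1 := by rw [dp_mul_dp]; exact dp_zero
    -- Applying ∂ lowers the degree of the kernel by one; the boundary term is the kernel on the
    -- diagonal, which is zero.
    have h : dp D w 1 * ∑ l ∈ Finset.HasAntidiagonal.antidiagonal (M + 1),
        (-1 : ℚ) ^ l.2 • (xpow D w x l.1 * dp D w (-1) * xpow D w x l.2) = dp D w (-M - 1) := by
      rw [← ih, Finset.mul_sum, Finset.Nat.sum_antidiagonal_succ]
      have h0 := sum_xpow_mul_xpow (D := D) (w := w) x M
      rw [Finset.Nat.sum_antidiagonal_succ] at h0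
      have h3 : ∀ l : ℕ × ℕ, dp D w 1 *
          ((-1 : ℚ) ^ l.2 • (xpow D w x (l.1 + 1) * dp D w (-1) * xpow D w x l.2)) =
          (-1 : ℚ) ^ l.2 • (xpow D w x (l.1 + 1) * xpow D w x l.2) +
          (-1 : ℚ) ^ l.2 • (xpow D w x l.1 * dp D w (-1) * xpow D w x l.2) := by
        intro l
        rw [mul_smul_comm, ← smul_add]
        congr 1
        rw [← mul_assoc, ← mul_assoc, dp_one_mul_xpow_succ hx, add_mul, add_mul,
          mul_assoc (xpow D w x (l.1 + 1)), hd, mul_one]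
      simp only [h3, Finset.sum_add_distrib]
      rw [← add_assoc, add_eq_right, ← h0]
      congr 1
      rw [mul_smul_comm, xpow_zero, one_mul, one_mul, ← mul_assoc, hd, one_mul]
    have h4 := congrArg (dp D w (-1) * ·) h
    simp only [← mul_assoc, hd', one_mul, dp_mul_dp] at h4
    rw [h4]
    congr 1
    push_cast
    ring

theorem dp_mul_xpow_one {x : R} (hx : D x = 1) (k : ℤ) :
    dp D w k * xpow D w x 1 = xpow D w x 1 * dp D w k + (k : ℚ) • dp D w (k - 1) := by
  have h1 : dp D w 1 * xpow D w x 1 = xpow D w x 1 * dp D w 1 + 1 := by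
    simpa [xpow_zero] using dp_one_mul_xpow_succ (w := w) hx 0
  have h2 : dp D w (-1) * xpow D w x 1 = xpow D w x 1 * dp D w (-1) - dp D w (-2) := by
    have := congrArg (fun A => dp D w (-1) * A * dp D w (-1)) h1
    simp only [mul_add, add_mul, mul_one, dp_mul_dp] at this
    simp only [mul_assoc, dp_mul_dp] at this
    simp only [← mul_assoc, dp_mul_dp] at this
    norm_num [dp_zero] at this
    rw [this, add_sub_cancel_right]
  induction k using Int.induction_on with
  | zero => simp [dp_zero]
  | succ k ih =>
    rw [show (k : ℤ) + 1 = k + 1 by ring, ← dp_mul_dp, mul_assoc, h1, mul_add, ← mul_assoc, ih,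
      mul_one, add_mul, mul_assoc, smul_mul_assoc, dp_mul_dp, dp_mul_dp]
    push_cast
    rw [add_smul, one_smul, sub_add_cancel, add_sub_cancel_right, add_assoc]
  | pred k ih =>
    rw [show -(k : ℤ) - 1 = -k + -1 by ring, ← dp_mul_dp, mul_assoc, h2, mul_sub, ← mul_assoc, ih,
      add_mul, mul_assoc, smul_mul_assoc, dp_mul_dp, dp_mul_dp, dp_mul_dp,
      show -(k : ℤ) - 1 + -1 = -k + -1 - 1 by ring, show -(k : ℤ) + -2 = -k + -1 - 1 by ring]
    push_cast
    module

/-- As l · x^l/l! = x · x^(l-1)/(l-1)!, the weight `l.1` pulls a factor x out on the left and `l.2`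
pulls out -x on the right. Moving the latter across ∂^(-M-1) produces the commutator term. -/
theorem sum_sub_xpow_dp_xpow {x : R} (hx : D x = 1) (M : ℕ) :
    ∑ l ∈ Finset.HasAntidiagonal.antidiagonal (M + 1), ((l.2 : ℚ) - l.1) •
        (-1 : ℚ) ^ l.2 • (xpow D w x l.1 * dp D w (-1) * xpow D w x l.2) =
      ((M : ℚ) + 1) • dp D w (-M - 2) - (2 : ℚ) • (xpow D w x 1 * dp D w (-M - 1)) := by
  have e1 : ∑ l ∈ Finset.HasAntidiagonal.antidiagonal (M + 1), (l.1 : ℚ) •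
      (-1 : ℚ) ^ l.2 • (xpow D w x l.1 * dp D w (-1) * xpow D w x l.2) =
      xpow D w x 1 * dp D w (-M - 1) := by
    rw [Finset.Nat.sum_antidiagonal_succ, ← sum_xpow_dp_xpow hx, Finset.mul_sum]
    simp only [Nat.cast_zero, zero_smul, zero_add, Nat.cast_succ]
    refine Finset.sum_congr rfl fun l _ => ?_
    rw [smul_comm, mul_smul_comm]
    congr 1
    rw [← smul_mul_assoc, ← smul_mul_assoc, succ_smul_xpow_succ]
    simp only [mul_assoc]
  have e2 : ∑ l ∈ Finset.HasAntidiagonal.antidiagonal (M + 1), (l.2 : ℚ) •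
      (-1 : ℚ) ^ l.2 • (xpow D w x l.1 * dp D w (-1) * xpow D w x l.2) =
      -(dp D w (-M - 1) * xpow D w x 1) := by
    rw [Finset.Nat.sum_antidiagonal_succ', ← sum_xpow_dp_xpow hx, Finset.sum_mul,
      ← Finset.sum_neg_distrib]
    simp only [Nat.cast_zero, zero_smul, zero_add, Nat.cast_succ]
    refine Finset.sum_congr rfl fun l _ => ?_
    rw [smul_comm, smul_mul_assoc, ← mul_smul_comm, succ_smul_xpow_succ, pow_succ,
      functions_mul_comm (xpow_mem_functions x 1) (xpow_mem_functions x l.2)]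
    simp only [mul_assoc, mul_neg, mul_one, neg_smul]
  simp only [sub_smul, Finset.sum_sub_distrib, e1, e2, dp_mul_xpow_one hx]
  rw [show -(M : ℤ) - 1 - 1 = -M - 2 by ring]
  push_cast
  module

end PDO

end

/-! ### The kernel identity behind Y_p. -/

section

variable {R : Type*} [CommRing R] [Algebra ℚ R]
variable {w : Weight} {D : Derivation ℚ R R}

namespace PDO

/-- The divided powers of `x`, extended by zero to negative exponents. -/
noncomputable def xpowInt (D : Derivation ℚ R R) (w : Weight) (x : R) (l : ℤ) : PDO D w :=
  if 0 ≤ l then xpow D w x l.toNat else 0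

theorem xpowInt_natCast (x : R) (l : ℕ) : xpowInt D w x l = xpow D w x l := by simp [xpowInt]

theorem xpowInt_neg (x : R) {l : ℤ} (hl : l < 0) : xpowInt D w x l = 0 := by
  simp [xpowInt, hl]

theorem xpowInt_mem_functions (x : R) (l : ℤ) : xpowInt D w x l ∈ functions D w := by
  rw [xpowInt]
  split_ifs
  · exact xpow_mem_functions _ _
  · exact zero_mem _

/-- The function `(A ∂^(-k))(1)`. -/
noncomputable def value (x : R) (A : PDO D w) (P : ℕ) (k : ℤ) : PDO D w :=
  ∑ a ∈ Finset.range P, coeff A a * xpowInt D w x (k - a)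

theorem value_mem_functions (x : R) (A : PDO D w) (P : ℕ) (k : ℤ) :
    value x A P k ∈ functions D w :=
  sum_mem fun a _ => mul_mem (coeff_mem_functions A a) (xpowInt_mem_functions x _)

/-- A bound `P` shared by all `k < P` allows the sums over `a` and `j` to be interchanged; the
surplus terms vanish because negative divided powers are zero. -/
theorem op_value (x : R) {A : PDO D w} (hA : A ∈ nonneg D w) {P k : ℕ} (hk : k < P) :
    (value x A P k).op = ofFn (applyOne x (A * dp D w (-k)).op) := by
  rw [ofFn_applyOne x hA, value]
  congr 1
  symm
  have hs : Finset.range (k + 1) ⊆ Finset.range P := by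
    intro a
    simp only [Finset.mem_range]
    omega
  rw [← Finset.sum_subset hs]
  · refine Finset.sum_congr rfl fun a ha => ?_
    rw [Finset.mem_range] at ha
    rw [← Nat.cast_sub (by omega), xpowInt_natCast]
  · intro a _ ha
    rw [Finset.mem_range] at ha
    rw [xpowInt_neg x (by omega), mul_zero]

/-- The kernel occurring in `Y_P`. -/
noncomputable def kernelSum (D : Derivation ℚ R R) (w : Weight) (x : R) (P a b : ℕ) : PDO D w :=
  ∑ j ∈ Finset.range P, ((2 * (j : ℚ) - (P : ℚ) + 1) / 2) • (-1 : ℚ) ^ j •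
    (xpowInt D w x (P - 1 - j - a) * dp D w (-1) * xpowInt D w x (j - b))

/-- The operator `x ∂^(1 - p) + (1 - p) / 2 ∂^(-p)`. -/
noncomputable def kernelOp (D : Derivation ℚ R R) (w : Weight) (x : R) (p : ℤ) : PDO D w :=
  xpow D w x 1 * dp D w (1 - p) + ((1 - (p : ℚ)) / 2) • dp D w (-p)

theorem dp_mul_kernelOp_mul_dp {x : R} (hx : D x = 1) (p a b : ℤ) :
    dp D w a * kernelOp D w x p * dp D w b = xpow D w x 1 * dp D w (a + b - p + 1) +
      ((a : ℚ) + (1 - p) / 2) • dp D w (a + b - p) := by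
  rw [kernelOp, mul_add, ← mul_assoc, dp_mul_xpow_one hx]
  simp only [add_mul, mul_assoc, smul_mul_assoc, mul_smul_comm, dp_mul_dp]
  rw [show a + (1 - p) + b = a + b - p + 1 by ring, show a - 1 + (1 - p) + b = a + b - p by ring,
    show a + -p + b = a + b - p by ring, add_assoc, add_smul]

/-- The two exponents add up to P - 1 - a - b < 0, so one of them is negative. -/
theorem kernelSum_eq_zero (x : R) {P a b : ℕ} (h : P ≤ a + b) : kernelSum D w x P a b = 0 := by
  refine Finset.sum_eq_zero fun j _ => ?_
  by_cases hj : j < b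
  · rw [xpowInt_neg x (l := j - b) (by omega)]; simp
  · rw [xpowInt_neg x (l := P - 1 - j - a) (by omega)]; simp

/-- Put j = b + l₂ and l₁ = P - 1 - a - j; then l₁ + l₂ = M and (2j - P + 1)/2 = (b - a)/2 + (l₂ -
l₁)/2. All other `j` give a negative exponent. -/
theorem kernelSum_eq (x : R) {P a b M : ℕ} (h : P = b + (M + 1 + a)) :
    kernelSum D w x P a b = (-1 : ℚ) ^ b • ∑ l ∈ Finset.HasAntidiagonal.antidiagonal M,
      (((b : ℚ) - a) / 2 + ((l.2 : ℚ) - l.1) / 2) • (-1 : ℚ) ^ l.2 •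
        (xpow D w x l.1 * dp D w (-1) * xpow D w x l.2) := by
  rw [kernelSum, h, Finset.sum_range_add, Finset.sum_range_add, Finset.sum_eq_zero, zero_add,
    add_eq_left.2, Finset.Nat.sum_antidiagonal_eq_sum_range_succ_mk, ← Finset.sum_range_reflect,
    Finset.smul_sum]
  · refine Finset.sum_congr rfl fun j hj => ?_
    have hj : j ≤ M := by simpa [Nat.lt_succ_iff] using hj
    obtain ⟨k, rfl⟩ := Nat.exists_eq_add_of_le hj
    rw [show j + k + 1 - 1 - j = k by omega, show j + k - j = k by omega,
      show ((b + (j + k + 1 + a) : ℕ) : ℤ) - 1 - (b + k : ℕ) - a = j by push_cast; ring,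
      show ((b + k : ℕ) : ℤ) - b = k by push_cast; ring, xpowInt_natCast, xpowInt_natCast,
      smul_smul, smul_smul, smul_smul]
    congr 1
    push_cast
    ring
  · refine Finset.sum_eq_zero fun j _ => ?_
    rw [xpowInt_neg x (by push_cast; omega)]; simp
  · intro j hj
    rw [Finset.mem_range] at hj
    rw [xpowInt_neg x (l := j - b) (by omega)]; simp

/-- For a + b ≥ P both terms are differential operators. Otherwise the x ∂^(-M) terms cancel when M
> 0, and the coefficient of ∂^(-M-1) is (b - a)/2 + M/2 + a + (1 - P)/2 = 0. This cancellation is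
what the values κ = -1/2 and λ = 1/2 achieve. -/
theorem kernelSum_add_mem_nonneg {x : R} (hx : D x = 1) (P a b : ℕ) :
    kernelSum D w x P a b + (-1 : ℚ) ^ b • (dp D w a * kernelOp D w x P * dp D w b) ∈
      nonneg D w := by
  have hX := functions_le_nonneg (xpow_mem_functions (D := D) (w := w) x 1)
  rw [dp_mul_kernelOp_mul_dp hx]
  rcases le_or_gt P (a + b) with h | h
  · rw [kernelSum_eq_zero x h, zero_add]
    exact Subalgebra.smul_mem _ (add_mem (mul_mem hX (dp_mem_nonneg (by omega)))
      (Subalgebra.smul_mem _ (dp_mem_nonneg (by omega)) _)) _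
  · obtain ⟨M, hM⟩ : ∃ M, P = b + (M + 1 + a) := ⟨P - 1 - a - b, by omega⟩
    rw [kernelSum_eq x hM, ← smul_add]
    refine Subalgebra.smul_mem _ ?_ _
    simp only [add_smul, Finset.sum_add_distrib]
    rw [← Finset.smul_sum, sum_xpow_dp_xpow hx, show ((a : ℕ) : ℤ) + (b : ℕ) - P = -M - 1 by
      rw [hM]; push_cast; ring, hM]
    cases M with
    -- For M = 0 the sum does not vanish: multiplication by x is left over, which is harmless.
    | zero =>
      have : xpow D w x 1 ∈ nonneg D w := hX
      simp only [Finset.HasAntidiagonal.antidiagonal_zero]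
      convert this using 1
      simp only [Finset.sum_singleton, CharP.cast_eq_zero, neg_zero, zero_sub, sub_self, zero_div,
        zero_smul, neg_add_cancel, dp_zero, mul_one, add_zero]
      push_cast
      module
    | succ M =>
      have h2 : ∑ l ∈ Finset.HasAntidiagonal.antidiagonal (M + 1), (((l.2 : ℚ) - l.1) / 2) •
          (-1 : ℚ) ^ l.2 • (xpow D w x l.1 * dp D w (-1) * xpow D w x l.2) =
          (1 / 2 : ℚ) • (((M : ℚ) + 1) • dp D w (-M - 2) -
            (2 : ℚ) • (xpow D w x 1 * dp D w (-M - 1))) := by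
        rw [← sum_sub_xpow_dp_xpow hx, Finset.smul_sum]
        refine Finset.sum_congr rfl fun l _ => ?_
        rw [smul_smul ((1 : ℚ) / 2)]
        congr 1
        ring
      rw [h2, show -((M + 1 : ℕ) : ℤ) - 1 + 1 = -M - 1 by push_cast; ring,
        show -((M + 1 : ℕ) : ℤ) - 1 = -M - 2 by push_cast; ring]
      convert zero_mem (nonneg D w)
      push_cast
      module

/-- The operator `Y_P` is minus the negative part of `A (x ∂^(1-P) + (1-P)/2 ∂^(-P)) B`. -/
theorem sum_value_add_mem_nonneg {x : R} (hx : D x = 1) {A B : PDO D w} (hA : A ∈ nonneg D w)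
    (hB : B ∈ nonneg D w) (P : ℕ) :
    ∑ j ∈ Finset.range P, ((2 * (j : ℚ) - (P : ℚ) + 1) / 2) •
        (value x A P (P - 1 - j) * dp D w (-1) * ((-1 : ℚ) ^ j • value x (adj B) P j)) +
      A * kernelOp D w x P * B ∈ nonneg D w := by
  obtain ⟨A', hA', eA⟩ := exists_eq_sum_coeff hA P
  -- Expanding the adjoint of `B` and taking adjoints back puts the coefficients on the right of the
  -- powers of ∂, as Y_P requires.
  obtain ⟨G', hG', eG⟩ := exists_eq_sum_coeff (adj_mem_nonneg hB) P
  have eB := congrArg adj eG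
  rw [adj_adj, map_add, map_sum, adj_mul, adj_dp, negOnePow_zsmul] at eB
  simp only [adj_mul, adj_dp, negOnePow_zsmul, adj_of_functions (coeff_mem_functions _ _)] at eB
  have h1 : ∑ j ∈ Finset.range P, ((2 * (j : ℚ) - (P : ℚ) + 1) / 2) •
      (value x A P (P - 1 - j) * dp D w (-1) * ((-1 : ℚ) ^ j • value x (adj B) P j)) =
      ∑ a ∈ Finset.range P, ∑ b ∈ Finset.range P,
        coeff A a * kernelSum D w x P a b * coeff (adj B) b := by
    have h : ∀ j a b : ℕ, coeff A a * xpowInt D w x (P - 1 - j - a) * dp D w (-1) *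
        (coeff (adj B) b * xpowInt D w x (j - b)) = coeff A a *
        (xpowInt D w x (P - 1 - j - a) * dp D w (-1) * xpowInt D w x (j - b)) *
          coeff (adj B) b := by
      intro j a b
      rw [functions_mul_comm (coeff_mem_functions (adj B) b) (xpowInt_mem_functions x _)]
      simp only [mul_assoc]
    simp only [value, kernelSum, Finset.mul_sum, Finset.sum_mul, Finset.smul_sum, mul_smul_comm,
      smul_mul_assoc, h]
    rw [Finset.sum_congr rfl fun _ _ => Finset.sum_comm, Finset.sum_comm]
    exact Finset.sum_congr rfl fun _ _ => Finset.sum_comm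
  have h2 : A * kernelOp D w x P * B = ∑ a ∈ Finset.range P, ∑ b ∈ Finset.range P,
      coeff A a * ((-1 : ℚ) ^ b • (dp D w a * kernelOp D w x P * dp D w b)) * coeff (adj B) b +
      (∑ a ∈ Finset.range P, coeff A a * (-1 : ℚ) ^ P •
        (dp D w a * kernelOp D w x P * dp D w P) * adj G' +
        A' * (dp D w P * kernelOp D w x P * dp D w 0) * B) := by
    -- `A` is truncated first; its tail keeps the full `B`, with ∂^0 inserted so that every piece
    -- has the form ∂^a K ∂^b.
    have h3 : A * kernelOp D w x P * B =
        (∑ a ∈ Finset.range P, coeff A a * dp D w a) * kernelOp D w x P * B +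
        A' * (dp D w P * kernelOp D w x P * dp D w 0) * B := by
      conv_lhs => rw [eA]
      rw [dp_zero, mul_one]
      noncomm_ring
    rw [h3, ← add_assoc]
    congr 1
    conv_lhs => rw [eB]
    rw [mul_add]
    simp only [Finset.mul_sum, Finset.sum_mul, mul_smul_comm, smul_mul_assoc, mul_assoc, Finset.smul_sum]
    rw [Finset.sum_comm]
  -- Both tails carry ∂^P on one side of the kernel, so this case disposes of them.
  have hnn : ∀ a b : ℕ, P ≤ a + b → dp D w a * kernelOp D w x P * dp D w b ∈ nonneg D w := by
    intro a b hab
    rw [dp_mul_kernelOp_mul_dp hx]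
    exact add_mem (mul_mem (functions_le_nonneg (xpow_mem_functions x 1))
      (dp_mem_nonneg (by omega))) (Subalgebra.smul_mem _ (dp_mem_nonneg (by omega)) _)
  rw [h1, h2, ← add_assoc, ← Finset.sum_add_distrib]
  refine add_mem (sum_mem fun a _ => ?_) (add_mem (sum_mem fun a _ => ?_) ?_)
  · rw [← Finset.sum_add_distrib]
    refine sum_mem fun b _ => ?_
    rw [← add_mul, ← mul_add]
    exact mul_mem (mul_mem (functions_le_nonneg (coeff_mem_functions _ _))
      (kernelSum_add_mem_nonneg hx P a b)) (functions_le_nonneg (coeff_mem_functions _ _))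
  · exact mul_mem (mul_mem (functions_le_nonneg (coeff_mem_functions _ _))
      (Subalgebra.smul_mem _ (hnn a P (by omega)) _)) (adj_mem_nonneg hG')
  · exact mul_mem (mul_mem hA' (hnn P 0 (by omega))) hB

end PDO

end

/-! ### The classes 𝒟⁻ and 𝒟⁺ and negative parts. -/

section

variable {R : Type*} [CommRing R] [Algebra ℚ R]
variable {𝒜 : ℤ → Submodule ℚ R} {D : Derivation ℚ R R}

/-- The order of bidegrees for operators of the first type. -/
def weightMinus : Weight where
  hom :=
    { toFun := fun p => toLex (-p.1, p.2)
      map_zero' := rfl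
      map_add' := fun p q => by
        rw [← toLex_add]; congr 1; ext <;> simp [add_comm] }
  inj := fun p q h => by
    have h := toLex.injective h
    simp only [Prod.mk.injEq, neg_inj] at h
    exact Prod.ext h.1 h.2
  pos := Prod.Lex.toLex_lt_toLex.2 (Or.inl (by simp))

/-- The order of bidegrees for operators of the second type. -/
def weightPlus : Weight where
  hom :=
    { toFun := fun p => toLex (p.1 + p.2, -p.1)
      map_zero' := rfl
      map_add' := fun p q => by
        rw [← toLex_add]; congr 1; ext <;> simp <;> ring }
  inj := fun p q h => by
    have h := toLex.injective h
    simp only [Prod.mk.injEq, neg_inj] at h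
    exact Prod.ext h.2 (by omega)
  -- A derivation preserves the total degree, so the second component must detect it.
  pos := Prod.Lex.toLex_lt_toLex.2 (Or.inr (by simp))

theorem isPWO_of_bound {s : Set ℤ} (k : ℤ) (h : ∀ a ∈ s, k ≤ a) : s.IsPWO :=
  (BddBelow.isWF ⟨k, h⟩).isPWO

theorem wfMinus_of_bound {X : Op R} {K : ℤ} (hK : ∀ i > K, X i = 0)
    (hX : ∀ i, ∃ k, ∀ j < k, X i j = 0) : X ∈ wf R weightMinus := by
  refine Set.PartiallyWellOrderedOn.subsetProdLex (isPWO_of_bound (-K) ?_) fun a => ?_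
  · rintro _ ⟨_, ⟨p, hp, rfl⟩, rfl⟩
    change -K ≤ -p.1
    by_contra h
    exact hp (by rw [hK _ (by omega)]; rfl)
  · obtain ⟨k, hk⟩ := hX (-a)
    refine isPWO_of_bound k ?_
    rintro b ⟨p, hp, h⟩
    have h := toLex.injective h
    simp only [Prod.mk.injEq] at h
    obtain ⟨rfl, rfl⟩ := h
    by_contra hb
    exact hp (by have := hk p.2 (by omega); rwa [neg_neg] at this)

theorem IsDminus.mem_wf {X : Op R} (hX : IsDminus 𝒜 X) : X ∈ wf R weightMinus := by
  obtain ⟨K, hK⟩ := hX.2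
  exact wfMinus_of_bound hK fun i => (hX.1 i).2

theorem IsDplus.mem_wf {X : Op R} (hX : IsDplus 𝒜 X) : X ∈ wf R weightPlus := by
  obtain ⟨_, ⟨k, hk⟩, hX⟩ := hX
  refine Set.PartiallyWellOrderedOn.subsetProdLex (isPWO_of_bound k ?_) fun a => ?_
  · rintro _ ⟨_, ⟨p, hp, rfl⟩, rfl⟩
    change k ≤ p.1 + p.2
    by_contra h
    exact hp (hk _ _ (by omega))
  · obtain ⟨K, hK⟩ := hX a
    refine isPWO_of_bound (-K) ?_
    rintro b ⟨p, hp, h⟩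
    have h := toLex.injective h
    simp only [Prod.mk.injEq] at h
    obtain ⟨rfl, rfl⟩ := h
    by_contra hb
    exact hp (by have := hK p.1 (by omega); rwa [add_sub_cancel_left] at this)

theorem neg_mem_wf {w : Weight} {X : Op R} (hX : X ∈ wf R w) : neg X ∈ wf R w := by
  refine wf_of_subset hX fun i j h h0 => h ?_
  rw [neg]
  split_ifs
  · exact h0
  · rfl

/-- The negative part of an operator of the second type is an operator of the first type. -/
theorem neg_mem_wfMinus {X : Op R} (hX : X ∈ wf R weightPlus) : neg X ∈ wf R weightMinus := by
  -- A lower bound `k` on the total degree bounds the degrees in order `i` below by `k - i`; the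
  -- negative part has order below zero.
  obtain ⟨k, hk⟩ : ∃ k : ℤ, ∀ i j, X i j ≠ 0 → k ≤ i + j := by
    have h := (Set.PartiallyWellOrderedOn.imageProdLex hX).isWF
    by_cases hn : ((fun x : ℤ ×ₗ ℤ => (ofLex x).1) '' (weightPlus.hom '' opSupp X)).Nonempty
    · exact ⟨h.min hn, fun i j hij => h.min_le hn ⟨_, mem_image_supp hij, rfl⟩⟩
    · refine ⟨0, fun i j hij => (hn ⟨_, _, mem_image_supp hij, rfl⟩).elim⟩
  refine wfMinus_of_bound (K := 0) (fun i hi => if_neg (by omega)) fun i => ⟨k - i, fun j hj => ?_⟩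
  rw [neg]
  split_ifs
  · by_contra h
    have := hk i j h
    omega
  · rfl

theorem neg_part_add (X Y : Op R) : neg (X + Y) = neg X + neg Y := by
  ext i j
  by_cases h : i < 0 <;> simp [neg, h]

theorem neg_part_smul (c : ℚ) (X : Op R) : neg (c • X) = c • neg X := by
  ext i j
  by_cases h : i < 0 <;> simp [neg, h]

theorem ofFn_homog (e : ℤ) (c : R) : ofFn (homog e c) = mono 0 e c := by
  ext i j
  by_cases h : i = 0 <;> simp [ofFn, mono, homog, h]

namespace PDO

variable {w : Weight}

theorem op_pow (A : PDO D w) (k : ℕ) : (A ^ k).op = npow D A.op k := by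
  induction k with
  | zero => rw [pow_zero]; rfl
  | succ k ih => rw [pow_succ', op_mul, ih]; rfl

/-- Used as L^k Φ̂ = Φ̂ ∂^(-k), which removes L from L^k(v). -/
theorem conj_pow_mul {A B : PDO D w} (h : B * A = 1) (k : ℕ) :
    (A * dp D w (-1) * B) ^ k * A = A * dp D w (-k) := by
  induction k with
  | zero => simp [dp_zero]
  | succ k ih =>
    rw [pow_succ', mul_assoc, ih, mul_assoc, ← mul_assoc B, h, one_mul, mul_assoc, dp_mul_dp]
    congr 2
    push_cast
    ring

theorem mul_conj_pow {A B : PDO D w} (h : B * A = 1) (k : ℕ) :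
    B * (A * dp D w (-1) * B) ^ k = dp D w (-k) * B := by
  induction k with
  | zero => simp [dp_zero]
  | succ k ih =>
    rw [pow_succ, ← mul_assoc, ih, mul_assoc, ← mul_assoc B, ← mul_assoc B, h, one_mul,
      ← mul_assoc, dp_mul_dp]
    congr 2
    push_cast
    ring

theorem adj_pow (A : PDO D w) (k : ℕ) : adj A ^ k = adj (A ^ k) := by
  induction k with
  | zero => simp
  | succ k ih => rw [pow_succ, ih, pow_succ', adj_mul]

theorem adj_dp_neg_mul (k : ℕ) (A : PDO D w) :
    adj (dp D w (-k) * A) = (-1 : ℚ) ^ k • (adj A * dp D w (-k)) := by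
  rw [adj_dp_mul, Int.negOnePow_neg, negOnePow_zsmul]

/-- Turns a congruence modulo differential operators into an equality of operators. -/
theorem neg_op_of_add_mem_nonneg {A B : PDO D w} (hA : ∀ i ≥ 0, A.op i = 0)
    (h : A + B ∈ nonneg D w) : A.op = -neg B.op := by
  funext i
  by_cases hi : i < 0
  · have := h i hi
    rw [op_add, Pi.add_apply] at this
    simp only [neg, Pi.neg_apply, hi, if_true]
    exact eq_neg_of_add_eq_zero_left this
  · simp [neg, hi, hA i (by omega)]

theorem op_mul_dp_mul_eq_zero {A B : PDO D w} (hA : A ∈ functions D w) (hB : B ∈ functions D w)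
    {i : ℤ} (hi : 0 ≤ i) : (A * dp D w (-1) * B).op i = 0 := by
  ext d
  by_contra h
  obtain ⟨i', j, r, _, ha, hb⟩ := exists_of_mul_ne_zero D h
  rw [op_mul_dp] at ha
  have h1 : i' - -1 = 0 := by
    by_contra h
    exact ha (by rw [hA _ h]; rfl)
  refine hb (by rw [hB _ (by omega)]; rfl)

end PDO

/-- The absence of negative powers in `A` makes the defining sum finite, so the scalar can be taken
out. -/
theorem applyOne_smul (x : R) {w : Weight} (c : ℚ) {A : PDO D w} (hA : A ∈ PDO.nonneg D w)
    (k : ℕ) : applyOne x (c • (A * PDO.dp D w (-k)).op) =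
      c • applyOne x (A * PDO.dp D w (-k)).op := by
  ext d
  simp only [applyOne, Pi.smul_apply]
  rw [smul_finsum']
  · refine finsum_congr fun l => ?_
    rw [smul_mul_assoc, smul_comm]
  · refine (Finset.range (k + 1)).finite_toSet.subset fun l hl => ?_
    by_contra h
    simp only [Finset.coe_range, Set.mem_Iio, not_lt] at h
    refine hl ?_
    beta_reduce
    rw [PDO.op_mul_dp, hA _ (by omega)]
    simp

/-! ### Y_p as a negative part, and equality of the two commutators. -/

section

variable {x : R} {Φ Φinv Φh Φhinv : Op R}

open PDO

/-- The operator `Y_p` is minus the negative part of `M̂ P̂^(p-1) + (1 - p)/2 P̂^p`. -/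
theorem opY_eq (hDx : D x = 1) (hΦ : IsDressing 𝒜 D Φ Φinv Φh Φhinv) (p : ℤ) :
    opY D x (Phpow D Φh Φhinv 1) Φh Φhinv p =
      -neg (mul D (opMh D x Φh Φhinv) (Phpow D Φh Φhinv (p - 1)) +
        (-1 / 2 * (p : ℚ) + 1 / 2) • Phpow D Φh Φhinv p) := by
  obtain ⟨A, hA⟩ : ∃ A : PDO D weightPlus, A.op = Φh := ⟨mk Φh hΦ.hat_mem.mem_wf, rfl⟩
  obtain ⟨B, hB⟩ : ∃ B : PDO D weightPlus, B.op = Φhinv := ⟨mk Φhinv hΦ.hat_inv_mem.mem_wf, rfl⟩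
  have hAn : A ∈ nonneg D weightPlus := by
    rw [mem_nonneg, hA]; exact hΦ.hat_coeff_neg
  have hBn : B ∈ nonneg D weightPlus := by
    rw [mem_nonneg, hB]; exact hΦ.hat_inv_coeff_neg
  have hBA : B * A = 1 := PDO.ext (by rw [op_mul, hA, hB]; exact hΦ.hat_inv_mul)
  have hP : ∀ k : ℤ, Phpow D Φh Φhinv k = (A * dp D _ (-k) * B).op := by
    intro k; rw [← hA, ← hB]; rfl
  have hM : opMh D x Φh Φhinv = (A * xpow D _ x 1 * B).op := by
    rw [← hA, ← hB, xpow_one, opMh, ofFn_homog]; rfl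
  -- The inner factors Φ̂⁻¹ Φ̂ cancel, leaving one conjugate of `kernelOp`.
  have hQ : mul D (opMh D x Φh Φhinv) (Phpow D Φh Φhinv (p - 1)) +
      (-1 / 2 * (p : ℚ) + 1 / 2) • Phpow D Φh Φhinv p = (A * kernelOp D _ x p * B).op := by
    rw [hP, hP, hM, ← op_mul, ← op_smul, ← op_add, kernelOp]
    congr 1
    rw [mul_add, add_mul, mul_smul_comm, smul_mul_assoc,
      show A * xpow D _ x 1 * B * (A * dp D _ (-(p - 1)) * B) =
        A * xpow D _ x 1 * (B * A) * dp D _ (-(p - 1)) * B by simp only [mul_assoc], hBA, mul_one,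
      neg_sub, ← mul_assoc]
    congr 2
    ring
  rw [hQ]
  by_cases hp : 2 ≤ p
  · obtain ⟨P, rfl⟩ := Int.eq_ofNat_of_zero_le (show 0 ≤ p by omega)
    have hY : opY D x (Phpow D Φh Φhinv 1) Φh Φhinv (P : ℤ) =
        (∑ j ∈ Finset.range P, ((2 * (j : ℚ) - (P : ℚ) + 1) / 2) •
          (value x A P (P - 1 - j) * dp D _ (-1) * ((-1 : ℚ) ^ j • value x (PDO.adj B) P j))).op := by
      rw [opY, if_pos hp, op_sum, Int.toNat_natCast]
      refine Finset.sum_congr rfl fun j hj => ?_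
      rw [Finset.mem_range] at hj
      have hV : ofFn (Lv D x (Phpow D Φh Φhinv 1) Φh (P - 1 - j)) =
          (value x A P (P - 1 - j)).op := by
        rw [show (P : ℤ) - 1 - j = ((P - 1 - j : ℕ) : ℤ) by omega,
          op_value x hAn (by omega), Lv, act, hP, ← op_pow]
        rw [← hA]
        rw [← op_mul, conj_pow_mul hBA]
      have hW : ofFn (Lw D x (Phpow D Φh Φhinv 1) Φhinv j) =
          ((-1 : ℚ) ^ j • value x (PDO.adj B) P j).op := by
        rw [op_smul, op_value x (adj_mem_nonneg hBn) hj, Lw, act, hP, ← op_adj, ← op_pow]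
        rw [← hB]
        rw [← op_adj, ← op_mul, adj_pow, ← adj_mul, mul_conj_pow hBA, adj_dp_neg_mul, op_smul,
          applyOne_smul x _ (adj_mem_nonneg hBn)]
        ext i d
        by_cases hi : i = 0 <;> simp [ofFn, hi]
      rw [hV, hW, Int.cast_natCast]
      rfl
    rw [hY]
    refine neg_op_of_add_mem_nonneg (fun i hi => ?_) (sum_value_add_mem_nonneg hDx hAn hBn P)
    rw [op_sum, Finset.sum_apply]
    refine Finset.sum_eq_zero fun j _ => ?_
    rw [op_smul, Pi.smul_apply, op_mul_dp_mul_eq_zero (value_mem_functions _ _ _ _)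
      (Subalgebra.smul_mem _ (value_mem_functions _ _ _ _) _) hi, smul_zero]
  -- For p ≤ 1 the kernel operator has no negative powers: at p = 1 the term ∂^(-1) has coefficient
  -- (1 - p)/2 = 0.
  · rw [opY, if_neg hp]
    refine neg_op_of_add_mem_nonneg (A := 0) (fun _ _ => rfl) ?_
    rw [zero_add]
    have hX := functions_le_nonneg (xpow_mem_functions (D := D) (w := weightPlus) x 1)
    refine mul_mem (mul_mem hAn ?_) hBn
    refine add_mem (mul_mem hX (dp_mem_nonneg (by omega))) ?_
    by_cases h1 : p = 1
    · rw [h1]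
      simp
    · exact Subalgebra.smul_mem _ (dp_mem_nonneg (by omega)) _

/-- The two flows are generated by the same operator. -/
theorem anpFlow_eq_reducedFlow (hDx : D x = 1) (t : ℕ → Fn R) (n : ℕ)
    (hΦ : IsDressing 𝒜 D Φ Φinv Φh Φhinv) (hL : Ppow D Φ Φinv n = Phpow D Φh Φhinv 1) (p : ℤ) :
    anpFlow D x t n Φ Φinv Φh Φhinv p =
      reducedFlow D x t n Φ Φinv Φh Φhinv (-1 / 2) (1 / 2) p := by
  have h := opY_eq hDx hΦ p
  -- The constraint enters here: Y_p is built from P^n, its formula from P̂.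
  rw [← hL] at h
  rw [anpFlow, reducedFlow, h, opS', opS, add_assoc]
  generalize mul D (opMh D x Φh Φhinv) (Phpow D Φh Φhinv (p - 1)) +
    (-1 / 2 * (p : ℚ) + 1 / 2) • Phpow D Φh Φhinv p = Q
  rw [neg_part_add, neg_part_smul, neg_add]

end

end

/-! ### Evolutionary derivations acting on 𝒟⁻. -/

section

variable {R : Type*} [CommRing R] [Algebra ℚ R]
variable (𝒜 : ℤ → Submodule ℚ R) {D : Derivation ℚ R R}

/-- The additive group of formal sums. -/
def fnSubgroup : AddSubgroup (Fn R) where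
  carrier := {g | IsFn 𝒜 g}
  zero_mem' := ⟨fun j => zero_mem (𝒜 j), 0, fun _ _ => rfl⟩
  add_mem' {g h} hg hh := by
    obtain ⟨hg, k, hk⟩ := hg
    obtain ⟨hh, l, hl⟩ := hh
    exact ⟨fun j => add_mem (hg j) (hh j), min k l, fun j hj => by
      rw [Pi.add_apply, hk j (by omega), hl j (by omega), add_zero]⟩
  neg_mem' {g} hg := ⟨fun j => neg_mem (hg.1 j), hg.2.imp fun k hk j hj => by simp [hk j hj]⟩

variable {𝒜}

theorem IsFn.fnMul [SetLike.GradedMonoid 𝒜] {g h : Fn R} (hg : IsFn 𝒜 g) (hh : IsFn 𝒜 h) :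
    IsFn 𝒜 (fnMul g h) := by
  obtain ⟨hg, k, hk⟩ := hg
  obtain ⟨hh, l, hl⟩ := hh
  refine ⟨fun d => ?_, k + l, fun d hd => finsum_eq_zero_of_forall_eq_zero fun j => ?_⟩
  · refine finsum_induction (· ∈ 𝒜 d) (zero_mem _) (fun _ _ => add_mem) fun j => ?_
    have := SetLike.GradedMul.mul_mem (hg j) (hh (d - j))
    rwa [add_sub_cancel] at this
  · by_cases hj : j < k
    · rw [hk j hj, zero_mul]
    · rw [hl (d - j) (by omega), mul_zero]

theorem IsFn.fnDer (hD : ∀ j : ℤ, ∀ a ∈ 𝒜 j, D a ∈ 𝒜 (j + 1)) {g : Fn R} (hg : IsFn 𝒜 g) :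
    IsFn 𝒜 (fnDer D g) := by
  obtain ⟨hg, k, hk⟩ := hg
  refine ⟨fun j => ?_, k + 1, fun j hj => ?_⟩
  · have := hD _ _ (hg (j - 1))
    rwa [sub_add_cancel] at this
  · rw [CKP.fnDer, hk _ (by omega), map_zero]

theorem IsFn.iterate_fnDer (hD : ∀ j : ℤ, ∀ a ∈ 𝒜 j, D a ∈ 𝒜 (j + 1)) {g : Fn R}
    (hg : IsFn 𝒜 g) (r : ℕ) : IsFn 𝒜 ((CKP.fnDer D)^[r] g) := by
  induction r with
  | zero => exact hg
  | succ r ih => rw [iterate_succ_apply']; exact ih.fnDer hD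

theorem iterate_fnDer_apply (g : Fn R) (r : ℕ) (j : ℤ) :
    (fnDer D)^[r] g j = D^[r] (g (j - r)) := by
  induction r generalizing j with
  | zero => simp
  | succ r ih =>
    rw [iterate_succ_apply', fnDer, ih, iterate_succ_apply']
    congr 3
    push_cast
    ring

theorem iterate_fnDer_zero (r : ℕ) : (fnDer D)^[r] (0 : Fn R) = 0 := by
  ext j
  simp [iterate_fnDer_apply, iterate_map_zero]

theorem zero_fnMul (g : Fn R) : fnMul 0 g = 0 := by
  ext d
  simp [fnMul]

theorem fnMul_zero (g : Fn R) : fnMul g 0 = 0 := by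
  ext d
  simp [fnMul]

/-- A coefficient of a product of operators of the first type is a finite sum. -/
theorem mul_eq_sum_fnMul {X Y : Op R} (hX : X ∈ wf R weightMinus) (hY : Y ∈ wf R weightMinus)
    {K K' : ℤ} (hK : ∀ i > K, X i = 0) (hK' : ∀ i > K', Y i = 0) (m : ℤ) :
    mul D X Y m = ∑ q ∈ Finset.Icc (m - K') K ×ˢ Finset.range (K + K' - m + 1).toNat,
      Ring.choose q.1 q.2 • fnMul (X q.1) ((fnDer D)^[q.2] (Y (m + q.2 - q.1))) := by
  ext d
  let e : (ℤ × ℕ) × ℤ ≃ ℤ × ℕ × ℤ := Equiv.prodAssoc ℤ ℕ ℤ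
  have hfin := (mul_finite D hX hY m d).preimage e.injective.injOn
  have hfib : ∀ q : ℤ × ℕ, ∑ᶠ j : ℤ, Ring.choose q.1 q.2 •
      (X q.1 j * D^[q.2] (Y (m + q.2 - q.1) (d - q.2 - j))) =
      Ring.choose q.1 q.2 • fnMul (X q.1) ((fnDer D)^[q.2] (Y (m + q.2 - q.1))) d := by
    intro q
    -- Finiteness of the inner sum is known only with the binomial factor present; a nonzero factor
    -- can be cancelled over ℚ.
    by_cases hq : Ring.choose q.1 q.2 = 0
    · simp [hq]
    · rw [fnMul, smul_finsum']
      · refine finsum_congr fun j => ?_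
        rw [iterate_fnDer_apply, sub_right_comm]
      · have := hfin.preimage (f := fun j : ℤ => (q, j))
          (by intro a _ b _ h; simpa using h)
        refine this.subset fun j hj h0 => hj ?_
        have h0 : Ring.choose q.1 q.2 • (X q.1 j * D^[q.2] (Y (m + q.2 - q.1) (d - q.2 - j))) = 0 :=
          h0
        beta_reduce
        rw [iterate_fnDer_apply, sub_right_comm]
        rw [← Int.cast_smul_eq_zsmul ℚ] at h0
        exact (smul_eq_zero.1 h0).resolve_left (Int.cast_ne_zero.2 hq)
  rw [mul, ← finsum_comp_equiv e, finsum_curry _ hfin]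
  refine (finsum_congr hfib).trans ?_
  rw [finsum_eq_finsetSum_of_support_subset]
  · rw [Finset.sum_apply]
    rfl
  · rintro ⟨i, r⟩ h
    by_contra hn
    refine h ?_
    simp only [Finset.coe_product, Finset.coe_Icc, Finset.coe_range, Set.mem_prod, Set.mem_Icc,
      Set.mem_Iio, not_and_or, not_le, not_lt] at hn
    beta_reduce
    by_cases hi : K < i
    · simp [hK i hi, zero_fnMul]
    · rw [hK' (m + r - i) (by omega), iterate_fnDer_zero, fnMul_zero]
      simp

namespace IsEvolution

variable {δ : Fn R → Fn R}

/-- The additive map given by an evolutionary derivation. -/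
def toAddMonoidHom (hδ : IsEvolution 𝒜 D δ) : fnSubgroup 𝒜 →+ Fn R :=
  AddMonoidHom.mk' (fun g => δ g) fun g h => hδ.add g h g.2 h.2

theorem map_zero (hδ : IsEvolution 𝒜 D δ) : δ 0 = 0 := hδ.toAddMonoidHom.map_zero

theorem map_sum_zsmul (hδ : IsEvolution 𝒜 D δ) {ι : Type*} (s : Finset ι) (c : ι → ℤ)
    (g : ι → Fn R) (hg : ∀ i, IsFn 𝒜 (g i)) :
    δ (∑ i ∈ s, c i • g i) = ∑ i ∈ s, c i • δ (g i) := by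
  have := map_sum hδ.toAddMonoidHom (fun i => c i • (⟨g i, hg i⟩ : fnSubgroup 𝒜)) s
  simp only [map_zsmul] at this
  refine (congrArg δ ?_).trans this
  simp

theorem iterate_fnDer (hD : ∀ j : ℤ, ∀ a ∈ 𝒜 j, D a ∈ 𝒜 (j + 1)) (hδ : IsEvolution 𝒜 D δ)
    {g : Fn R} (hg : IsFn 𝒜 g) (r : ℕ) : δ ((fnDer D)^[r] g) = (fnDer D)^[r] (δ g) := by
  induction r with
  | zero => rfl
  | succ r ih => rw [iterate_succ_apply', hδ.comm _ (hg.iterate_fnDer hD r), ih, iterate_succ_apply']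

theorem opMap_mem (hδ : IsEvolution 𝒜 D δ) {X : Op R} (hX : IsDminus 𝒜 X) :
    IsDminus 𝒜 (opMap δ X) :=
  ⟨fun i => hδ.mem _ (hX.1 i), hX.2.imp fun k hk i hi => by rw [opMap, hk i hi, hδ.map_zero]⟩

/-- The Leibniz rule for the coefficientwise action on operators of the first type. -/
theorem opMap_mul [SetLike.GradedMonoid 𝒜] (hD : ∀ j : ℤ, ∀ a ∈ 𝒜 j, D a ∈ 𝒜 (j + 1))
    (hδ : IsEvolution 𝒜 D δ) {X Y : Op R} (hX : IsDminus 𝒜 X) (hY : IsDminus 𝒜 Y) :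
    opMap δ (mul D X Y) = mul D (opMap δ X) Y + mul D X (opMap δ Y) := by
  obtain ⟨K, hK⟩ := hX.2
  obtain ⟨K', hK'⟩ := hY.2
  -- The action of δ does not raise the order, so one finite index set serves all three products.
  have hδX : ∀ i > K, opMap δ X i = 0 := fun i hi => by rw [opMap, hK i hi, hδ.map_zero]
  have hδY : ∀ i > K', opMap δ Y i = 0 := fun i hi => by rw [opMap, hK' i hi, hδ.map_zero]
  funext m
  rw [opMap, mul_eq_sum_fnMul hX.mem_wf hY.mem_wf hK hK', hδ.map_sum_zsmul, Pi.add_apply,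
    mul_eq_sum_fnMul (hδ.opMap_mem hX).mem_wf hY.mem_wf hδX hK',
    mul_eq_sum_fnMul hX.mem_wf (hδ.opMap_mem hY).mem_wf hK hδY, ← Finset.sum_add_distrib]
  · refine Finset.sum_congr rfl fun q _ => ?_
    rw [hδ.leibniz _ _ (hX.1 _) ((hY.1 _).iterate_fnDer hD _), hδ.iterate_fnDer hD (hY.1 _),
      smul_add]
    rfl
  · exact fun q => (hX.1 _).fnMul ((hY.1 _).iterate_fnDer hD _)

theorem map_one [SetLike.GradedOne 𝒜] (hδ : IsEvolution 𝒜 D δ) : δ (homog 0 1) = 0 := by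
  have h1 : IsFn 𝒜 (homog 0 (1 : R)) := by
    refine ⟨fun j => ?_, 0, fun j hj => if_neg hj.ne⟩
    rw [homog]
    split_ifs with h
    · rw [h]; exact SetLike.GradedOne.one_mem
    · exact zero_mem _
  have hl : ∀ g : Fn R, fnMul (homog 0 1) g = g := by
    intro g
    ext d
    rw [fnMul, finsum_eq_single _ 0 fun j hj => by simp [homog, hj]]
    simp [homog]
  have hr : ∀ g : Fn R, fnMul g (homog 0 1) = g := by
    intro g
    ext d
    rw [fnMul, finsum_eq_single _ d fun j hj => by simp [homog, sub_eq_zero, hj.symm]]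
    simp [homog]
  have := hδ.leibniz _ _ h1 h1
  rw [hl, hl, hr] at this
  simpa using this

end IsEvolution

/-- Right multiplication by ∂^k only shifts indices, so it commutes with every coefficientwise map.
-/
theorem opMap_mul_dpow (δ : Fn R → Fn R) (X : Op R) (k : ℤ) :
    opMap δ (mul D X (dpow k)) = mul D (opMap δ X) (dpow k) := by
  have h : ∀ Y : Op R, mul D Y (dpow k) = fun i => Y (i - k) := by
    intro Y
    ext i j
    exact mul_dpow_apply D k i j
  rw [h, h]
  rfl

theorem IsDminus.mul_dpow {X : Op R} (hX : IsDminus 𝒜 X) (k : ℤ) :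
    IsDminus 𝒜 (mul D X (dpow k)) := by
  have h : mul D X (dpow k) = fun i => X (i - k) := by
    ext i j
    exact mul_dpow_apply D k i j
  rw [h]
  refine ⟨fun i => hX.1 _, ?_⟩
  obtain ⟨K, hK⟩ := hX.2
  exact ⟨K + k, fun i hi => hK _ (by omega)⟩

theorem IsTimes.isDminus_Xi {x : R} {t : ℕ → Fn R} (ht : IsTimes 𝒜 D x t) :
    IsDminus 𝒜 (Xi t) := by
  refine ⟨fun i => ?_, ?_⟩
  · rw [Xi]
    split_ifs
    · exact (fnSubgroup 𝒜).zsmul_mem (ht.mem _) _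
    · exact zero_mem (fnSubgroup 𝒜)
  · obtain ⟨N, hN⟩ := ht.finite
    refine ⟨N, fun i hi => ?_⟩
    rw [Xi, hN _ (by omega)]
    simp

/-- If `δΦ = -S Φ`, then `δ(Φ ∂^k Φ⁻¹) = [-S, Φ ∂^k Φ⁻¹]`. -/
theorem opMap_Ppow [SetLike.GradedMonoid 𝒜] (hD : ∀ j : ℤ, ∀ a ∈ 𝒜 j, D a ∈ 𝒜 (j + 1))
    {δ : Fn R → Fn R} (hδ : IsEvolution 𝒜 D δ) {Φ Φinv S : Op R} (hΦ : IsDminus 𝒜 Φ)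
    (hΦinv : IsDminus 𝒜 Φinv) (h1 : mul D Φ Φinv = dpow 0) (h2 : mul D Φinv Φ = dpow 0)
    (hS : S ∈ wf R weightMinus) (hδΦ : opMap δ Φ = -mul D S Φ) (k : ℤ) :
    opMap δ (Ppow D Φ Φinv k) = comm D (-S) (Ppow D Φ Φinv k) := by
  have h3 : mul D (opMap δ Φ) Φinv + mul D Φ (opMap δ Φinv) = 0 := by
    rw [← hδ.opMap_mul hD hΦ hΦinv, h1]
    funext i
    rw [opMap, dpow]
    split_ifs
    · exact hδ.map_one
    · exact hδ.map_zero
  rw [Ppow, hδ.opMap_mul hD (hΦ.mul_dpow k) hΦinv, opMap_mul_dpow, comm]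
  obtain ⟨A, rfl⟩ : ∃ A : PDO D weightMinus, A.op = Φ := ⟨PDO.mk Φ hΦ.mem_wf, rfl⟩
  obtain ⟨B, rfl⟩ : ∃ B : PDO D weightMinus, B.op = Φinv := ⟨PDO.mk Φinv hΦinv.mem_wf, rfl⟩
  obtain ⟨S, rfl⟩ : ∃ S' : PDO D weightMinus, S'.op = S := ⟨PDO.mk S hS, rfl⟩
  obtain ⟨B', hB'⟩ : ∃ B' : PDO D weightMinus, B'.op = opMap δ B.op :=
    ⟨PDO.mk _ (hδ.opMap_mem hΦinv).mem_wf, rfl⟩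
  rw [hδΦ, ← hB'] at h3 ⊢
  have h1 : A * B = 1 := PDO.ext h1
  have h2 : B * A = 1 := PDO.ext h2
  have h3 : -(S * A) * B + A * B' = 0 := PDO.ext h3
  -- Differentiating ΦΦ⁻¹ = 1 gives δΦ⁻¹ = Φ⁻¹ S.
  have h4 : B' = B * S := by
    have := congrArg (B * ·) h3
    simp only [mul_add, neg_mul, mul_neg, mul_zero, mul_assoc, h1, mul_one] at this
    rw [← mul_assoc, h2, one_mul] at this
    exact (neg_add_eq_zero.1 this).symm
  have h5 : -(S * A) * PDO.dp D _ k * B + A * PDO.dp D _ k * B' =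
      -S * (A * PDO.dp D _ k * B) - A * PDO.dp D _ k * B * -S := by
    rw [h4]
    noncomm_ring
  exact congrArg PDO.op h5

end

end CKP

theorem mainTheorem5 {R : Type*} [CommRing R] [Algebra ℚ R]
    (𝒜 : ℤ → Submodule ℚ R) [GradedAlgebra 𝒜]
    (D : Derivation ℚ R R) (hD : ∀ j : ℤ, ∀ a ∈ 𝒜 j, D a ∈ 𝒜 (j + 1))
    (x : R) (hx : x ∈ 𝒜 (-1)) (hDx : D x = 1)
    (t : ℕ → CKP.Fn R) (ht : CKP.IsTimes 𝒜 D x t)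
    (n : ℕ) (hn : 1 ≤ n)
    (Φ Φinv Φh Φhinv : CKP.Op R) (hΦ : CKP.IsDressing 𝒜 D Φ Φinv Φh Φhinv)
    (hL : CKP.Ppow D Φ Φinv n = CKP.Phpow D Φh Φhinv 1)
    (p : ℤ) (hp : -1 ≤ p) :
    CKP.anpFlow D x t n Φ Φinv Φh Φhinv p =
        CKP.reducedFlow D x t n Φ Φinv Φh Φhinv (-1 / 2) (1 / 2) p ∧
      ∀ δ δ' : CKP.Fn R → CKP.Fn R,
        CKP.IsEvolution 𝒜 D δ → CKP.IsEvolution 𝒜 D δ' →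
        CKP.opMap δ (CKP.Ppow D Φ Φinv n) = CKP.anpFlow D x t n Φ Φinv Φh Φhinv p →
        CKP.opMap δ' Φ =
          -CKP.mul D (CKP.neg (CKP.opS' D x t n Φ Φinv Φh Φhinv (-1 / 2) (1 / 2) p)) Φ →
        CKP.opMap δ' Φh =
          CKP.mul D (CKP.pos (CKP.opS' D x t n Φ Φinv Φh Φhinv (-1 / 2) (1 / 2) p)) Φh →
        CKP.opMap δ (CKP.Ppow D Φ Φinv n) = CKP.opMap δ' (CKP.Ppow D Φ Φinv n) := by
  have hflow := CKP.anpFlow_eq_reducedFlow hDx t n hΦ hL p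
  refine ⟨hflow, fun δ δ' _ hδ' hδL hδΦ _ => ?_⟩
  have hΦm := hΦ.mem.mem_wf
  have hΦim := hΦ.inv_mem.mem_wf
  have hΦhm := hΦ.hat_mem.mem_wf
  have hΦhim := hΦ.hat_inv_mem.mem_wf
  have hP : ∀ k, CKP.Ppow D Φ Φinv k ∈ CKP.wf R CKP.weightMinus := fun k =>
    CKP.mul_mem_wf D (CKP.mul_mem_wf D hΦm (CKP.dpow_mem_wf k)) hΦim
  have hPh : ∀ k, CKP.Phpow D Φh Φhinv k ∈ CKP.wf R CKP.weightPlus := fun k =>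
    CKP.mul_mem_wf D (CKP.mul_mem_wf D hΦhm (CKP.dpow_mem_wf (-k))) hΦhim
  have hM : CKP.opM D t Φ Φinv ∈ CKP.wf R CKP.weightMinus :=
    CKP.mul_mem_wf D (CKP.mul_mem_wf D hΦm ht.isDminus_Xi.mem_wf) hΦim
  have hMh : CKP.opMh D x Φh Φhinv ∈ CKP.wf R CKP.weightPlus := by
    rw [CKP.opMh, CKP.ofFn_homog]
    exact CKP.mul_mem_wf D (CKP.mul_mem_wf D hΦhm (CKP.mono_mem_wf 0 (-1) x)) hΦhim
  -- The M-part lies in the first class and the hatted part in the second, so the negative part is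
  -- split before membership is checked.
  have hS : CKP.neg (CKP.opS' D x t n Φ Φinv Φh Φhinv (-1 / 2) (1 / 2) p) ∈
      CKP.wf R CKP.weightMinus := by
    rw [CKP.opS', CKP.opS, add_assoc, CKP.neg_part_add]
    exact add_mem (CKP.neg_mem_wf (Submodule.smul_mem _ _ (CKP.mul_mem_wf D hM (hP _))))
      (CKP.neg_mem_wfMinus (add_mem (CKP.mul_mem_wf D hMh (hPh _)) (Submodule.smul_mem _ _ (hPh _))))
  rw [hδL, hflow, CKP.reducedFlow,
    CKP.opMap_Ppow hD hδ' hΦ.mem hΦ.inv_mem hΦ.mul_inv hΦ.inv_mul hS hδΦ]
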